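/- Let $\mathbb G$ be a compact quantum group, i.e. a unital C*-algebra $A=C(\mathbb G)\neq 0$ with a coassociative unital $*$-homomorphism $\Delta\colon A\to A\otimes A$ (minimal tensor product) such that the linear spans of $(A\otimes 1)\Delta(A)$ and $(1\otimes A)\Delta(A)$ are dense in $A\otimes A$. Let $U\in B(H)\otimes A$ be a finite-dimensional unitary representation of $\mathbb G$, so $U$ is unitary and $(\mathrm{id}\otimes\Delta)(U)=U_{12}U_{13}$. For representations $V,W$ put $\operatorname{Mor}(V,W)=\{T\in B(H_V,H_W): W(T\otimes 1)=(T\otimes 1)V\}$ and $\operatorname{End}(V)=\operatorname{Mor}(V,V)$. The contragredient of $V$ is $V^{c}=(j\otimes\mathrm{id})(V^{-1})$, where $j\colon B(H_V)\to B(\overline{H_V})$ is the transposition $j(T)\bar\xi=\overline{T^*\xi}$, and $V^{cc}=(V^c)^c$. Let $\rho_U$ be the unique positive invertible operator in $\operatorname{Mor}(U,U^{cc})$ such that $$\operatorname{Tr}(T\rho_U)=\operatorname{Tr}(T\rho_U^{-1})\qquad\text{for all } T\in\operatorname{End}(U).$$ For $n\in\mathbb N$ let $P_U(n)=\max\{\dim\alpha_1,\dots,\dim\alpha_N\}$,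 where $\alpha_1,\dots,\alpha_N$ are irreducible unitary representations such that the $n$-th tensor power $U^{\otimes n}$ is equivalent to $\alpha_1\oplus\dots\oplus\alpha_N$ (with $P_U(n)=0$ if $U^{\otimes n}$ is zero-dimensional). Suppose that $$\lim_{n\to\infty}\frac{P_U(n)}{c^n}=0\qquad\text{for every } c>1.$$ Then $\rho_U$ has symmetric eigenvalues: the list of the eigenvalues of $\rho_U$, counted with multiplicities and in descending order, equals the list of the eigenvalues of $\rho_U^{-1}$, counted with multiplicities and in descending order. -/

import Mathlib

open scoped TensorProduct InnerProductSpace ComplexOrder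
open UniformSpace

noncomputable section

universe u

namespace CQG

/-! ### The Hilbert space tensor product -/

section HilbertTensor

variable (H K : Type u) [NormedAddCommGroup H] [InnerProductSpace ℂ H]
  [NormedAddCommGroup K] [InnerProductSpace ℂ K]

/-- The Hilbert space tensor product: the completion of the algebraic tensor product `H ⊗ K` for
the inner product `⟪ξ ⊗ η, ξ' ⊗ η'⟫ = ⟪ξ, ξ'⟫ * ⟪η, η'⟫`. -/
def HilbertTensor : Type u := Completion (H ⊗[ℂ] K)

instance : NormedAddCommGroup (HilbertTensor H K) :=
  inferInstanceAs (NormedAddCommGroup (Completion (H ⊗[ℂ] K)))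
instance : InnerProductSpace ℂ (HilbertTensor H K) :=
  inferInstanceAs (InnerProductSpace ℂ (Completion (H ⊗[ℂ] K)))
instance : CompleteSpace (HilbertTensor H K) :=
  inferInstanceAs (CompleteSpace (Completion (H ⊗[ℂ] K)))

variable {H K}

/-- The inclusion of the algebraic tensor product in the Hilbert space tensor product. -/
def HilbertTensor.of (x : H ⊗[ℂ] K) : HilbertTensor H K := (x : Completion (H ⊗[ℂ] K))

theorem HilbertTensor.of_add (x y : H ⊗[ℂ] K) : of (x + y) = of x + of y := Completion.coe_add x y

theorem HilbertTensor.of_smul (c : ℂ) (x : H ⊗[ℂ] K) : of (c • x) = c • of x :=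
  Completion.coe_smul c x

theorem HilbertTensor.norm_of (x : H ⊗[ℂ] K) : ‖of x‖ = ‖x‖ := Completion.norm_coe x

theorem HilbertTensor.inner_of (x y : H ⊗[ℂ] K) : inner ℂ (of x) (of y) = inner ℂ x y :=
  Completion.inner_coe x y

theorem HilbertTensor.denseRange_of : DenseRange (of (H := H) (K := K)) :=
  Completion.denseRange_coe

/-- The bounded operator `S ⊗ T` on the Hilbert space tensor product. -/
def opTensor (S : H →L[ℂ] H) (T : K →L[ℂ] K) : HilbertTensor H K →L[ℂ] HilbertTensor H K :=
  (TensorProduct.mapL S T).completion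

theorem opTensor_of (S : H →L[ℂ] H) (T : K →L[ℂ] K) (x : H ⊗[ℂ] K) :
    opTensor S T (.of x) = .of (TensorProduct.mapL S T x) :=
  ContinuousLinearMap.completion_apply_coe _ x

theorem HilbertTensor.op_ext {S T : HilbertTensor H K →L[ℂ] HilbertTensor H K}
    (h : ∀ x, S (of x) = T (of x)) : S = T :=
  ContinuousLinearMap.ext fun x => denseRange_of.induction_on x
    (isClosed_eq S.continuous T.continuous) h

theorem norm_opTensor_le (S : H →L[ℂ] H) (T : K →L[ℂ] K) : ‖opTensor S T‖ ≤ ‖S‖ * ‖T‖ := by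
  refine ContinuousLinearMap.opNorm_le_bound _ (by positivity) fun x => ?_
  refine HilbertTensor.denseRange_of.induction_on x ?_ fun a => ?_
  · exact isClosed_le (continuous_norm.comp (opTensor S T).continuous)
      (continuous_const.mul continuous_norm)
  · rw [opTensor_of, HilbertTensor.norm_of, HilbertTensor.norm_of]
    exact ContinuousLinearMap.le_of_opNorm_le _ (TensorProduct.norm_mapL_le S T) a

theorem opTensor_add_left (S S' : H →L[ℂ] H) (T : K →L[ℂ] K) :
    opTensor (S + S') T = opTensor S T + opTensor S' T := by
  refine HilbertTensor.op_ext fun x => ?_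
  rw [add_apply, opTensor_of, opTensor_of, opTensor_of,
    TensorProduct.mapL_add_left, ← HilbertTensor.of_add]
  rfl

theorem opTensor_add_right (S : H →L[ℂ] H) (T T' : K →L[ℂ] K) :
    opTensor S (T + T') = opTensor S T + opTensor S T' := by
  refine HilbertTensor.op_ext fun x => ?_
  rw [add_apply, opTensor_of, opTensor_of, opTensor_of,
    TensorProduct.mapL_add_right, ← HilbertTensor.of_add]
  rfl

theorem opTensor_smul_left (c : ℂ) (S : H →L[ℂ] H) (T : K →L[ℂ] K) :
    opTensor (c • S) T = c • opTensor S T := by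
  refine HilbertTensor.op_ext fun x => ?_
  rw [smul_apply, opTensor_of, opTensor_of,
    TensorProduct.mapL_smul_left, ← HilbertTensor.of_smul]
  rfl

theorem opTensor_smul_right (c : ℂ) (S : H →L[ℂ] H) (T : K →L[ℂ] K) :
    opTensor S (c • T) = c • opTensor S T := by
  refine HilbertTensor.op_ext fun x => ?_
  rw [smul_apply, opTensor_of, opTensor_of,
    TensorProduct.mapL_smul_right, ← HilbertTensor.of_smul]
  rfl

theorem opTensor_mul (S S' : H →L[ℂ] H) (T T' : K →L[ℂ] K) :
    opTensor (S * S') (T * T') = opTensor S T * opTensor S' T' := by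
  refine HilbertTensor.op_ext fun x => ?_
  rw [mul_apply_eq_comp, opTensor_of, opTensor_of, opTensor_of,
    TensorProduct.mapL_mul]
  rfl

theorem opTensor_one : opTensor (1 : H →L[ℂ] H) (1 : K →L[ℂ] K) = 1 := by
  refine HilbertTensor.op_ext fun x => ?_
  rw [opTensor_of, one_apply_eq_self]
  exact congrArg HilbertTensor.of (congrArg (fun f => f x) (TensorProduct.mapL_id_id (𝕜 := ℂ)))

theorem opTensor_star [CompleteSpace H] [CompleteSpace K] (S : H →L[ℂ] H) (T : K →L[ℂ] K) :
    opTensor (star S) (star T) = star (opTensor S T) := by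
  rw [ContinuousLinearMap.star_eq_adjoint (opTensor S T),
    ContinuousLinearMap.eq_adjoint_iff]
  intro x y
  refine HilbertTensor.denseRange_of.induction_on₂ ?_ (fun ξ η => ?_) x y
  · exact isClosed_eq (((opTensor _ _).continuous.comp continuous_fst).inner continuous_snd)
      (continuous_fst.inner ((opTensor _ _).continuous.comp continuous_snd))
  · rw [opTensor_of, opTensor_of, HilbertTensor.inner_of, HilbertTensor.inner_of]
    induction ξ with
    | zero => simp only [map_zero, inner_zero_left]
    | add ξ₁ ξ₂ h₁ h₂ => rw [map_add, inner_add_left, inner_add_left, h₁, h₂]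
    | tmul u v =>
      induction η with
      | zero => simp only [map_zero, inner_zero_right]
      | add η₁ η₂ h₁ h₂ => rw [map_add, inner_add_right, inner_add_right, h₁, h₂]
      | tmul u' v' =>
        simp only [TensorProduct.mapL_tmul, TensorProduct.inner_tmul,
          ContinuousLinearMap.star_eq_adjoint, ContinuousLinearMap.adjoint_inner_left]

end HilbertTensor

/-! ### The minimal tensor product of unital C*-algebras -/

/-- A unital `*`-representation of a C*-algebra on a Hilbert space. -/
structure HilbertRep (A : Type u) [CStarAlgebra A] : Type (u + 1) where
  /-- the Hilbert space -/
  H : Type u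
  [instNormed : NormedAddCommGroup H]
  [instInner : InnerProductSpace ℂ H]
  [instComplete : CompleteSpace H]
  /-- the representation -/
  π : A →⋆ₐ[ℂ] (H →L[ℂ] H)

attribute [instance] HilbertRep.instNormed HilbertRep.instInner HilbertRep.instComplete

section MinTensor

variable {A B C D : Type u} [CStarAlgebra A] [CStarAlgebra B] [CStarAlgebra C] [CStarAlgebra D]

theorem star_mul_tensor (x y : A ⊗[ℂ] B) : star (x * y) = star y * star x := by
  induction x with
  | zero => simp
  | add x₁ x₂ h₁ h₂ => rw [add_mul, star_add, h₁, h₂, star_add, mul_add]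
  | tmul a b =>
    induction y with
    | zero => simp
    | add y₁ y₂ h₁ h₂ => rw [mul_add, star_add, h₁, h₂, star_add, add_mul]
    | tmul a' b' => simp

/-- The `*`-algebra structure on `A ⊗ B` with `(a ⊗ b)⋆ = a⋆ ⊗ b⋆`. -/
instance instStarRingTensor : StarRing (A ⊗[ℂ] B) where
  star_mul := star_mul_tensor
  star_add := star_add

/-- The algebra homomorphism underlying `HilbertRep.tensor`. -/
def HilbertRep.tensorAlgHom (σ : HilbertRep A) (τ : HilbertRep B) :
    A ⊗[ℂ] B →ₐ[ℂ] (HilbertTensor σ.H τ.H →L[ℂ] HilbertTensor σ.H τ.H) :=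
  Algebra.TensorProduct.algHomOfLinearMapTensorProduct
    (TensorProduct.lift (LinearMap.mk₂ ℂ
      (fun a b => opTensor (σ.π a) (τ.π b))
      (fun a a' b => by rw [map_add, opTensor_add_left])
      (fun c a b => by rw [map_smul, opTensor_smul_left])
      (fun a b b' => by rw [map_add, opTensor_add_right])
      (fun c a b => by rw [map_smul, opTensor_smul_right])))
    (fun a a' b b' => by simp only [TensorProduct.lift.tmul, LinearMap.mk₂_apply, map_mul,
      opTensor_mul])
    (by simp only [TensorProduct.lift.tmul, LinearMap.mk₂_apply, map_one, opTensor_one])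

/-- The representation `π₁ ⊗ π₂` of the algebraic tensor product `A ⊗ B` on the Hilbert space
tensor product `H₁ ⊗ H₂`, with `(π₁ ⊗ π₂)(a ⊗ b) = π₁(a) ⊗ π₂(b)`. -/
def HilbertRep.tensor (σ : HilbertRep A) (τ : HilbertRep B) :
    A ⊗[ℂ] B →⋆ₐ[ℂ] (HilbertTensor σ.H τ.H →L[ℂ] HilbertTensor σ.H τ.H) where
  __ := σ.tensorAlgHom τ
  map_star' x := by
    change σ.tensorAlgHom τ (star x) = star (σ.tensorAlgHom τ x)
    induction x with
    | zero => rw [star_zero, map_zero, star_zero]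
    | add x y hx hy => rw [star_add, map_add, hx, hy, map_add, star_add]
    | tmul a b =>
      change opTensor (σ.π (star a)) (τ.π (star b)) = star (opTensor (σ.π a) (τ.π b))
      rw [map_star, map_star, opTensor_star]

theorem HilbertRep.tensor_tmul (σ : HilbertRep A) (τ : HilbertRep B) (a : A) (b : B) :
    σ.tensor τ (a ⊗ₜ b) = opTensor (σ.π a) (τ.π b) := rfl

theorem HilbertRep.bddAbove_tensor (x : A ⊗[ℂ] B) :
    BddAbove (Set.range fun p : HilbertRep A × HilbertRep B => ‖p.1.tensor p.2 x‖) := by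
  induction x with
  | zero => exact ⟨0, by rintro _ ⟨p, rfl⟩; simp⟩
  | add x y hx hy =>
    obtain ⟨M, hM⟩ := hx
    obtain ⟨N, hN⟩ := hy
    refine ⟨M + N, ?_⟩
    rintro _ ⟨p, rfl⟩
    simp only [map_add]
    exact (norm_add_le _ _).trans (add_le_add (hM ⟨p, rfl⟩) (hN ⟨p, rfl⟩))
  | tmul a b =>
    refine ⟨‖a‖ * ‖b‖, ?_⟩
    rintro _ ⟨p, rfl⟩
    simp only [HilbertRep.tensor_tmul]
    refine (norm_opTensor_le _ _).trans ?_
    gcongr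
    · exact NonUnitalStarAlgHom.norm_apply_le p.1.π a
    · exact NonUnitalStarAlgHom.norm_apply_le p.2.π b

/-- The minimal (spatial) C*-seminorm on the algebraic tensor product:
`‖x‖ = sup ‖(π₁ ⊗ π₂)(x)‖` over all representations `π₁` of `A` and `π₂` of `B`. -/
def minNorm (x : A ⊗[ℂ] B) : ℝ :=
  ⨆ p : HilbertRep A × HilbertRep B, ‖p.1.tensor p.2 x‖

theorem HilbertRep.norm_tensor_le (σ : HilbertRep A) (τ : HilbertRep B) (x : A ⊗[ℂ] B) :
    ‖σ.tensor τ x‖ ≤ minNorm x :=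
  le_ciSup (HilbertRep.bddAbove_tensor x) (σ, τ)

theorem minNorm_nonneg (x : A ⊗[ℂ] B) : 0 ≤ minNorm x :=
  Real.iSup_nonneg fun _ => norm_nonneg _

theorem minNorm_le {x : A ⊗[ℂ] B} {M : ℝ} (hM : 0 ≤ M)
    (h : ∀ (σ : HilbertRep A) (τ : HilbertRep B), ‖σ.tensor τ x‖ ≤ M) : minNorm x ≤ M :=
  Real.iSup_le (fun p => h p.1 p.2) hM

theorem minNorm_mul_self_le (x : A ⊗[ℂ] B) : minNorm x * minNorm x ≤ minNorm (star x * x) := by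
  have h : minNorm x ≤ Real.sqrt (minNorm (star x * x)) := by
    refine minNorm_le (Real.sqrt_nonneg _) fun σ τ => ?_
    refine Real.le_sqrt_of_sq_le ?_
    rw [sq, ← CStarRing.norm_star_mul_self, ← map_star, ← map_mul]
    exact σ.norm_tensor_le τ _
  calc minNorm x * minNorm x ≤ _ := mul_le_mul h h (minNorm_nonneg _) (Real.sqrt_nonneg _)
    _ = _ := Real.mul_self_sqrt (minNorm_nonneg _)

theorem minNorm_mul_le (x y : A ⊗[ℂ] B) : minNorm (x * y) ≤ minNorm x * minNorm y := by
  refine minNorm_le (mul_nonneg (minNorm_nonneg _) (minNorm_nonneg _)) fun σ τ => ?_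
  rw [map_mul]
  exact (norm_mul_le _ _).trans (mul_le_mul (σ.norm_tensor_le τ x) (σ.norm_tensor_le τ y)
    (norm_nonneg _) (minNorm_nonneg _))

theorem minNorm_smul_le (c : ℂ) (x : A ⊗[ℂ] B) : minNorm (c • x) ≤ ‖c‖ * minNorm x := by
  refine minNorm_le (mul_nonneg (norm_nonneg _) (minNorm_nonneg _)) fun σ τ => ?_
  rw [map_smul, norm_smul]
  exact mul_le_mul_of_nonneg_left (σ.norm_tensor_le τ x) (norm_nonneg _)

theorem minNorm_star_le (x : A ⊗[ℂ] B) : minNorm (star x) ≤ minNorm x := by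
  have h := (minNorm_mul_self_le (star x)).trans (minNorm_mul_le _ _)
  rw [star_star] at h
  rcases (minNorm_nonneg (star x)).eq_or_lt with h0 | h0
  · rw [← h0]; exact minNorm_nonneg x
  · exact le_of_mul_le_mul_right h h0

variable (A B) in
/-- The algebraic tensor product `A ⊗ B`, to be normed by `minNorm`. -/
def PreMinTensor : Type u := A ⊗[ℂ] B

instance : Ring (PreMinTensor A B) := inferInstanceAs (Ring (A ⊗[ℂ] B))
instance : Algebra ℂ (PreMinTensor A B) := inferInstanceAs (Algebra ℂ (A ⊗[ℂ] B))
instance : StarRing (PreMinTensor A B) := inferInstanceAs (StarRing (A ⊗[ℂ] B))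
instance : StarModule ℂ (PreMinTensor A B) := inferInstanceAs (StarModule ℂ (A ⊗[ℂ] B))

/-- `minNorm` as a seminorm of additive groups. -/
def minSeminorm : AddGroupSeminorm (PreMinTensor A B) where
  toFun := minNorm (A := A) (B := B)
  map_zero' := le_antisymm (minNorm_le le_rfl fun σ τ => by
    change ‖σ.tensor τ (0 : A ⊗[ℂ] B)‖ ≤ 0
    rw [map_zero, norm_zero]) (minNorm_nonneg _)
  add_le' x y := minNorm_le (add_nonneg (minNorm_nonneg _) (minNorm_nonneg _)) fun σ τ => by
    exact (congrArg norm (map_add (σ.tensor τ) (x : A ⊗[ℂ] B) y)).le.trans <| (norm_add_le _ _).trans (add_le_add (σ.norm_tensor_le τ x) (σ.norm_tensor_le τ y))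
  neg' x := by
    unfold minNorm
    congr 1
    funext p
    exact (congrArg norm (map_neg (p.1.tensor p.2) (x : A ⊗[ℂ] B))).trans (norm_neg _)

instance : SeminormedAddCommGroup (PreMinTensor A B) :=
  (minSeminorm (A := A) (B := B)).toSeminormedAddCommGroup

theorem preNorm_def (x : PreMinTensor A B) : ‖x‖ = minNorm (A := A) (B := B) x := rfl

instance : SeminormedRing (PreMinTensor A B) where
  __ := (inferInstance : SeminormedAddCommGroup (PreMinTensor A B))
  __ := (inferInstance : Ring (PreMinTensor A B))
  norm_mul_le x y := minNorm_mul_le (A := A) (B := B) x y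

instance : NormedAlgebra ℂ (PreMinTensor A B) where
  norm_smul_le c x := minNorm_smul_le (A := A) (B := B) c x

instance : NormedStarGroup (PreMinTensor A B) where
  norm_star_le x := minNorm_star_le (A := A) (B := B) x

variable (A B) in
/-- The minimal tensor product `A ⊗ B` of unital C*-algebras: the (Hausdorff) completion of the
algebraic tensor product in the minimal C*-norm. -/
def MinTensor : Type u := Completion (PreMinTensor A B)

instance : NormedRing (MinTensor A B) :=
  inferInstanceAs (NormedRing (Completion (PreMinTensor A B)))
instance : CompleteSpace (MinTensor A B) :=
  inferInstanceAs (CompleteSpace (Completion (PreMinTensor A B)))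

instance : NormedAlgebra ℂ (MinTensor A B) where
  __ := (inferInstance : Algebra ℂ (Completion (PreMinTensor A B)))
  norm_smul_le c x := norm_smul_le (β := Completion (PreMinTensor A B)) c x

/-- The canonical ring homomorphism from the algebraic to the minimal tensor product. -/
def ofRingHom : A ⊗[ℂ] B →+* MinTensor A B :=
  Completion.coeRingHom (α := PreMinTensor A B)

theorem denseRange_ofRingHom : DenseRange (ofRingHom (A := A) (B := B)) :=
  Completion.denseRange_coe (α := PreMinTensor A B)

theorem norm_ofRingHom (x : A ⊗[ℂ] B) : ‖ofRingHom x‖ = minNorm x :=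
  Completion.norm_coe (E := PreMinTensor A B) x

instance : Star (MinTensor A B) where
  star := Completion.map (star : PreMinTensor A B → PreMinTensor A B)

theorem star_ofRingHom (x : A ⊗[ℂ] B) : star (ofRingHom x) = ofRingHom (star x) :=
  Completion.map_coe (α := PreMinTensor A B) (β := PreMinTensor A B)
    (starNormedAddGroupHom (E := PreMinTensor A B)).uniformContinuous x

theorem continuous_star_min : Continuous (star : MinTensor A B → MinTensor A B) :=
  Completion.continuous_map

instance : StarRing (MinTensor A B) where
  star_involutive x := by
    refine denseRange_ofRingHom.induction_on x
      (isClosed_eq (continuous_star_min.comp continuous_star_min) continuous_id) fun a => ?_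
    rw [star_ofRingHom, star_ofRingHom, star_star]
  star_mul x y := by
    refine denseRange_ofRingHom.induction_on₂ ?_ (fun a b => ?_) x y
    · exact isClosed_eq (continuous_star_min.comp (continuous_fst.mul continuous_snd))
        ((continuous_star_min.comp continuous_snd).mul (continuous_star_min.comp continuous_fst))
    · rw [← map_mul, star_ofRingHom, star_mul, map_mul, star_ofRingHom, star_ofRingHom]
  star_add x y := by
    refine denseRange_ofRingHom.induction_on₂ ?_ (fun a b => ?_) x y
    · exact isClosed_eq (continuous_star_min.comp (continuous_fst.add continuous_snd))
        ((continuous_star_min.comp continuous_fst).add (continuous_star_min.comp continuous_snd))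
    · rw [← map_add, star_ofRingHom, star_add, map_add, star_ofRingHom, star_ofRingHom]

theorem ofRingHom_smul (c : ℂ) (x : A ⊗[ℂ] B) : ofRingHom (c • x) = c • ofRingHom x :=
  Completion.coe_smul (X := PreMinTensor A B) c x

instance : CStarAlgebra (MinTensor A B) where
  star_smul c x := by
    refine denseRange_ofRingHom.induction_on x ?_ fun a => ?_
    · exact isClosed_eq (continuous_star_min.comp (continuous_const_smul c))
        (continuous_star_min.const_smul (star c))
    · rw [← ofRingHom_smul, star_ofRingHom, star_smul, ofRingHom_smul, star_ofRingHom]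
  norm_mul_self_le x := by
    refine denseRange_ofRingHom.induction_on x ?_ fun a => ?_
    · exact isClosed_le (continuous_norm.mul continuous_norm)
        (continuous_norm.comp (continuous_star_min.mul continuous_id))
    · rw [star_ofRingHom, ← map_mul, norm_ofRingHom, norm_ofRingHom]
      exact minNorm_mul_self_le a

namespace MinTensor

/-- The canonical `*`-homomorphism from the algebraic to the minimal tensor product. -/
def of : A ⊗[ℂ] B →⋆ₐ[ℂ] MinTensor A B where
  __ := ofRingHom
  commutes' c := by
    change ofRingHom (algebraMap ℂ (A ⊗[ℂ] B) c) = _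
    rw [Algebra.algebraMap_eq_smul_one, Algebra.algebraMap_eq_smul_one, ofRingHom_smul, map_one]
  map_star' x := (star_ofRingHom x).symm

/-- The elementary tensor `a ⊗ b` in the minimal tensor product. -/
def tmul (a : A) (b : B) : MinTensor A B := of (a ⊗ₜ[ℂ] b)

theorem norm_of (x : A ⊗[ℂ] B) : ‖of x‖ = minNorm x := norm_ofRingHom x

theorem denseRange_of : DenseRange (of (A := A) (B := B)) := denseRange_ofRingHom

/-- Pull back a representation along a `*`-homomorphism. -/
def _root_.CQG.HilbertRep.comp (σ : HilbertRep C) (φ : A →⋆ₐ[ℂ] C) : HilbertRep A where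
  H := σ.H
  π := σ.π.comp φ

theorem minNorm_map_le (φ : A →⋆ₐ[ℂ] C) (ψ : B →⋆ₐ[ℂ] D) (x : A ⊗[ℂ] B) :
    minNorm (Algebra.TensorProduct.map φ.toAlgHom ψ.toAlgHom x) ≤ minNorm x := by
  refine minNorm_le (minNorm_nonneg _) fun σ τ => ?_
  have h : σ.tensor τ (Algebra.TensorProduct.map φ.toAlgHom ψ.toAlgHom x) =
      (σ.comp φ).tensor (τ.comp ψ) x := by
    induction x with
    | zero => rw [map_zero, map_zero, map_zero]; rfl
    | add x y hx hy => rw [map_add, map_add, map_add, hx, hy]; rfl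
    | tmul a b =>
      rw [Algebra.TensorProduct.map_tmul, HilbertRep.tensor_tmul, HilbertRep.tensor_tmul]
      rfl
  rw [h]
  exact HilbertRep.norm_tensor_le _ _ x

/-- The algebraic tensor product of two `*`-homomorphisms, as a ring homomorphism. -/
def preMap (φ : A →⋆ₐ[ℂ] C) (ψ : B →⋆ₐ[ℂ] D) : PreMinTensor A B →+* PreMinTensor C D :=
  (Algebra.TensorProduct.map φ.toAlgHom ψ.toAlgHom : A ⊗[ℂ] B →ₐ[ℂ] C ⊗[ℂ] D).toRingHom

theorem continuous_preMap (φ : A →⋆ₐ[ℂ] C) (ψ : B →⋆ₐ[ℂ] D) : Continuous (preMap φ ψ) :=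
  AddMonoidHomClass.continuous_of_bound (preMap φ ψ) 1 fun x => by
    rw [one_mul]; exact minNorm_map_le φ ψ x

/-- The underlying ring homomorphism of `MinTensor.map`. -/
def mapRingHom (φ : A →⋆ₐ[ℂ] C) (ψ : B →⋆ₐ[ℂ] D) : MinTensor A B →+* MinTensor C D :=
  Completion.mapRingHom (preMap φ ψ) (continuous_preMap φ ψ)

theorem mapRingHom_of (φ : A →⋆ₐ[ℂ] C) (ψ : B →⋆ₐ[ℂ] D) (x : A ⊗[ℂ] B) :
    mapRingHom φ ψ (of x) = of (Algebra.TensorProduct.map φ.toAlgHom ψ.toAlgHom x) :=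
  Completion.mapRingHom_coe (continuous_preMap φ ψ) x

theorem continuous_mapRingHom (φ : A →⋆ₐ[ℂ] C) (ψ : B →⋆ₐ[ℂ] D) :
    Continuous (mapRingHom φ ψ) :=
  Completion.continuous_map (f := preMap φ ψ)

/-- The `*`-homomorphism `φ ⊗ ψ` between minimal tensor products. -/
def map (φ : A →⋆ₐ[ℂ] C) (ψ : B →⋆ₐ[ℂ] D) : MinTensor A B →⋆ₐ[ℂ] MinTensor C D where
  __ := mapRingHom φ ψ
  commutes' c := by
    change mapRingHom φ ψ (algebraMap ℂ _ c) = _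
    rw [← (of (A := A) (B := B)).toAlgHom.commutes c]
    change mapRingHom φ ψ (of (algebraMap ℂ _ c)) = _
    rw [mapRingHom_of, AlgHom.commutes]
    exact (of (A := C) (B := D)).toAlgHom.commutes c
  map_star' x := by
    change mapRingHom φ ψ (star x) = star (mapRingHom φ ψ x)
    refine denseRange_of.induction_on x ?_ fun a => ?_
    · exact isClosed_eq ((continuous_mapRingHom φ ψ).comp continuous_star)
        (continuous_star.comp (continuous_mapRingHom φ ψ))
    · rw [← map_star of, mapRingHom_of, mapRingHom_of, ← map_star of]
      congr 1
      induction a with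
      | zero => simp
      | add x y hx hy => rw [star_add, map_add, hx, hy, map_add, star_add]
      | tmul a b =>
        rw [TensorProduct.star_tmul, Algebra.TensorProduct.map_tmul,
          Algebra.TensorProduct.map_tmul, TensorProduct.star_tmul]
        exact congrArg₂ _ (map_star φ a) (map_star ψ b)

theorem map_tmul (φ : A →⋆ₐ[ℂ] C) (ψ : B →⋆ₐ[ℂ] D) (a : A) (b : B) :
    map φ ψ (tmul a b) = tmul (φ a) (ψ b) :=
  (mapRingHom_of φ ψ (a ⊗ₜ b)).trans (by rw [Algebra.TensorProduct.map_tmul]; rfl)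

end MinTensor

end MinTensor

/-! ### Compact quantum groups -/

/-- A compact quantum group: a unital C*-algebra `A = C(G)` with a coassociative unital
`*`-homomorphism `Δ : A → A ⊗ A` such that `(A ⊗ 1)Δ(A)` and `(1 ⊗ A)Δ(A)` have dense linear
spans in `A ⊗ A`. -/
structure CompactQuantumGroup : Type (u + 1) where
  /-- the C*-algebra of continuous functions -/
  A : Type u
  [instCStar : CStarAlgebra A]
  [instNontrivial : Nontrivial A]
  /-- the comultiplication -/
  Δ : A →⋆ₐ[ℂ] MinTensor A A
  /-- `(Δ ⊗ id)Δ = (id ⊗ Δ)Δ`, where `(A ⊗ A) ⊗ A` and `A ⊗ (A ⊗ A)` are identified by the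
  canonical isomorphism `α`, which is the only `*`-isomorphism with the property that is listed
  first. -/
  coassoc : ∃ α : MinTensor (MinTensor A A) A ≃⋆ₐ[ℂ] MinTensor A (MinTensor A A),
    (∀ a b c : A, α (.tmul (.tmul a b) c) = .tmul a (.tmul b c)) ∧
      ∀ a : A, α (MinTensor.map Δ (StarAlgHom.id ℂ A) (Δ a)) =
        MinTensor.map (StarAlgHom.id ℂ A) Δ (Δ a)
  dense_left :
    Dense (Submodule.span ℂ {x : MinTensor A A | ∃ a b : A, x = .tmul a 1 * Δ b} :
      Set (MinTensor A A))
  dense_right :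
    Dense (Submodule.span ℂ {x : MinTensor A A | ∃ a b : A, x = .tmul 1 a * Δ b} :
      Set (MinTensor A A))

attribute [instance] CompactQuantumGroup.instCStar CompactQuantumGroup.instNontrivial

section Matrices

variable {A : Type u} [CStarAlgebra A] {ι κ : Type} [Fintype ι] [DecidableEq ι]
  [Fintype κ] [DecidableEq κ]

/-- The matrix `T ⊗ 1` over `A` of a complex matrix `T`. -/
def amp (A : Type u) [CStarAlgebra A] {ι κ : Type} (T : Matrix κ ι ℂ) : Matrix κ ι A :=
  T.map (algebraMap ℂ A)

/-- The space of intertwiners `Mor(M, N) = {T | N (T ⊗ 1) = (T ⊗ 1) M}`. -/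
def Mor (M : Matrix ι ι A) (N : Matrix κ κ A) : Set (Matrix κ ι ℂ) :=
  {T | N * amp A T = amp A T * M}

/-- The contragredient `Mᶜ = (j ⊗ id)(M⁻¹)` of an invertible matrix `M` over `A`, where `j` is
transposition `B(H) → B(H̄)`, i.e. `(Mᶜ) i j = (M⁻¹) j i`. (The value is `0` if `M` is not
invertible.) -/
def contragredient (M : Matrix ι ι A) : Matrix ι ι A := (Ring.inverse M).transpose

end Matrices

variable {G : CompactQuantumGroup.{u}}

/-- A finite dimensional unitary representation `U ∈ B(H) ⊗ C(G)` of a compact quantum group,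
written as a matrix over `C(G)` in an orthonormal basis of `H` indexed by `idx`: a unitary matrix
with `(id ⊗ Δ)(U) = U₁₂ U₁₃`. -/
structure UnitaryRep (G : CompactQuantumGroup.{u}) : Type (u + 1) where
  /-- the index set of the orthonormal basis -/
  idx : Type
  [instFintype : Fintype idx]
  [instDecEq : DecidableEq idx]
  /-- the matrix coefficients -/
  mat : Matrix idx idx G.A
  mem_unitary : mat ∈ unitary (Matrix idx idx G.A)
  comul : ∀ i j, G.Δ (mat i j) = ∑ k, MinTensor.tmul (mat i k) (mat k j)

attribute [instance] UnitaryRep.instFintype UnitaryRep.instDecEq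

theorem MinTensor.tmul_mul {A B : Type u} [CStarAlgebra A] [CStarAlgebra B] (a a' : A) (b b' : B) :
    tmul a b * tmul a' b' = tmul (a * a') (b * b') := by
  rw [tmul, tmul, tmul, ← map_mul, Algebra.TensorProduct.tmul_mul_tmul]

namespace UnitaryRep

/-- The dimension of a representation. -/
def dim (U : UnitaryRep G) : ℕ := Fintype.card U.idx

/-- The trivial representation. -/
def trivial (G : CompactQuantumGroup.{u}) : UnitaryRep G where
  idx := Unit
  mat := 1
  mem_unitary := one_mem _
  comul i j := by simp [MinTensor.tmul, ← Algebra.TensorProduct.one_def]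

/-- The matrix of the tensor product of representations, `U₁₃ V₂₃`. -/
def tensorMat {A : Type u} [CStarAlgebra A] {ι κ : Type} (M : Matrix ι ι A) (N : Matrix κ κ A) :
    Matrix (ι × κ) (ι × κ) A :=
  fun p q => M p.1 q.1 * N p.2 q.2

theorem tensorMat_unitary {A : Type u} [CStarAlgebra A] {ι κ : Type} [Fintype ι] [DecidableEq ι]
    [Fintype κ] [DecidableEq κ] {M : Matrix ι ι A} {N : Matrix κ κ A}
    (hM : M ∈ unitary (Matrix ι ι A)) (hN : N ∈ unitary (Matrix κ κ A)) :
    tensorMat M N ∈ unitary (Matrix (ι × κ) (ι × κ) A) := by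
  rw [Unitary.mem_iff] at hM hN ⊢
  constructor
  · ext ⟨i, k⟩ ⟨j, l⟩
    have h1 : ∀ i j, ∑ x, star (M x i) * M x j = if i = j then 1 else 0 := fun i j => by
      simpa [Matrix.mul_apply, Matrix.star_apply, Matrix.one_apply] using congrFun₂ hM.1 i j
    have h2 : ∀ i j, ∑ x, star (N x i) * N x j = if i = j then 1 else 0 := fun i j => by
      simpa [Matrix.mul_apply, Matrix.star_apply, Matrix.one_apply] using congrFun₂ hN.1 i j
    rw [Matrix.mul_apply, Fintype.sum_prod_type_right]
    have e : ∀ y : κ, ∑ x : ι, star (tensorMat M N) (i, k) (x, y) * tensorMat M N (x, y) (j, l) =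
        star (N y k) * (if i = j then 1 else 0) * N y l := fun y => by
      rw [← h1, Finset.mul_sum, Finset.sum_mul]
      refine Finset.sum_congr rfl fun x _ => ?_
      simp [Matrix.star_apply, tensorMat, mul_assoc]
    simp only [e]
    by_cases hij : i = j
    · simp [hij, h2, Matrix.one_apply]
    · simp [hij]
  · ext ⟨i, k⟩ ⟨j, l⟩
    have h1 : ∀ i j, ∑ x, M i x * star (M j x) = if i = j then 1 else 0 := fun i j => by
      simpa [Matrix.mul_apply, Matrix.star_apply, Matrix.one_apply] using congrFun₂ hM.2 i j
    have h2 : ∀ i j, ∑ x, N i x * star (N j x) = if i = j then 1 else 0 := fun i j => by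
      simpa [Matrix.mul_apply, Matrix.star_apply, Matrix.one_apply] using congrFun₂ hN.2 i j
    rw [Matrix.mul_apply, Fintype.sum_prod_type]
    have e : ∀ x : ι, ∑ y : κ, tensorMat M N (i, k) (x, y) * star (tensorMat M N) (x, y) (j, l) =
        M i x * (if k = l then 1 else 0) * star (M j x) := fun x => by
      rw [← h2, Finset.mul_sum, Finset.sum_mul]
      refine Finset.sum_congr rfl fun y _ => ?_
      simp [Matrix.star_apply, tensorMat, mul_assoc]
    simp only [e]
    by_cases hkl : k = l
    · simp [hkl, h1, Matrix.one_apply]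
    · simp [hkl]

/-- The tensor product of two representations. -/
def tensor (U V : UnitaryRep G) : UnitaryRep G where
  idx := U.idx × V.idx
  mat := tensorMat U.mat V.mat
  mem_unitary := tensorMat_unitary U.mem_unitary V.mem_unitary
  comul p q := by
    rw [tensorMat, map_mul, U.comul, V.comul, Finset.sum_mul_sum, Fintype.sum_prod_type]
    simp only [MinTensor.tmul_mul, tensorMat]

/-- The tensor powers of a representation; the power of order `0` is the trivial representation. -/
def tpow (U : UnitaryRep G) : ℕ → UnitaryRep G
  | 0 => trivial G
  | n + 1 => (U.tpow n).tensor U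

/-- The direct sum of finitely many representations. -/
def directSum {N : ℕ} (α : Fin N → UnitaryRep G) : UnitaryRep G where
  idx := Σ k, (α k).idx
  mat := Matrix.blockDiagonal' fun k => (α k).mat
  mem_unitary := by
    rw [Unitary.mem_iff, Matrix.star_eq_conjTranspose, Matrix.blockDiagonal'_conjTranspose,
      ← Matrix.blockDiagonal'_mul, ← Matrix.blockDiagonal'_mul]
    have h1 : ∀ k, (α k).mat.conjTranspose * (α k).mat = 1 := fun k =>
      (Unitary.mem_iff.mp (α k).mem_unitary).1
    have h2 : ∀ k, (α k).mat * (α k).mat.conjTranspose = 1 := fun k =>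
      (Unitary.mem_iff.mp (α k).mem_unitary).2
    simp only [h1, h2]
    exact ⟨Matrix.blockDiagonal'_one, Matrix.blockDiagonal'_one⟩
  comul := by
    rintro ⟨k, i⟩ ⟨l, j⟩
    rw [Fintype.sum_sigma, Finset.sum_eq_single k]
    · simp only [Matrix.blockDiagonal'_apply_eq]
      by_cases h : k = l
      · subst h
        simp only [Matrix.blockDiagonal'_apply_eq]
        exact (α k).comul i j
      · simp [Matrix.blockDiagonal'_apply_ne _ _ _ h, MinTensor.tmul]
    · intro m _ hm
      refine Finset.sum_eq_zero fun x _ => ?_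
      rw [Matrix.blockDiagonal'_apply_ne _ _ _ hm.symm]
      simp [MinTensor.tmul]
    · simp

/-- Equivalence of representations: there is an invertible intertwiner. -/
def Equivalent (U V : UnitaryRep G) : Prop :=
  ∃ S ∈ Mor U.mat V.mat, ∃ T ∈ Mor V.mat U.mat, T * S = 1 ∧ S * T = 1

/-- A representation is irreducible if it is nonzero and has no invariant subspaces besides `0` and
the whole space; a subspace is given by its orthogonal projection `e`, and it is invariant if
`U (e ⊗ 1) = (e ⊗ 1) U (e ⊗ 1)`. -/
def Irreducible (U : UnitaryRep G) : Prop :=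
  Nonempty U.idx ∧ ∀ e : Matrix U.idx U.idx ℂ, IsStarProjection e →
    U.mat * amp G.A e = amp G.A e * U.mat * amp G.A e → e = 0 ∨ e = 1

/-- The dimensions of the irreducible representations in decompositions of `V` into irreducibles. -/
def irrDims (V : UnitaryRep G) : Set ℕ :=
  {d | ∃ (N : ℕ) (α : Fin N → UnitaryRep G), (∀ k, (α k).Irreducible) ∧
    V.Equivalent (directSum α) ∧ ∃ k, (α k).dim = d}

/-- `P_U(n)`: the maximal dimension of the irreducible representations `α₁, …, α_N` such that the
`n`-th tensor power of `U` is equivalent to `α₁ ⊕ ⋯ ⊕ α_N`. -/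
def P (U : UnitaryRep G) (n : ℕ) : ℕ := sSup (U.tpow n).irrDims

/-- `ρ = ρ_U`: the positive (invertible) element `ρ` of `Mor(U, Uᶜᶜ)` such that
`Tr(T ρ) = Tr(T ρ⁻¹)` for all `T ∈ End(U)`. -/
structure IsRho (U : UnitaryRep G) (ρ : Matrix U.idx U.idx ℂ) : Prop where
  posDef : ρ.PosDef
  mem_mor : ρ ∈ Mor U.mat (contragredient (contragredient U.mat))
  trace_eq : ∀ T ∈ Mor U.mat U.mat, (T * ρ).trace = (T * ρ⁻¹).trace

end UnitaryRep

end CQG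

end

/-! Write `ρ` for the modular operator of `U`. A list of positive eigenvalues is determined by its
power sums, so it is enough to show `Tr(ρ^s) = Tr(ρ⁻ˢ)` for every `s`.

On a component of dimension `d` the operator restricts to a positive `r` with `Tr r = Tr r⁻¹`. Each
eigenvalue of `r` is at most `Tr r = Tr r⁻¹`, so the power mean inequality gives `Tr(r^s) ≤ d^s
Tr(r⁻ˢ)`, and the same with `r` and `r⁻¹` exchanged (`Matrix.PosDef.re_trace_pow_le`). The constant
is harmless after passing to tensor powers. The operator of `U^{⊗n}` is `ρ^{⊗n}`, whose traces are
`n`-th powers, and its irreducible components have dimension at most `P_U(n)`. Summing over them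
gives `Tr(ρ^s)^n ≤ P_U(n)^s Tr(ρ⁻ˢ)^n`. As `P_U(n)` grows subexponentially, `Tr(ρ^s) ≤ Tr(ρ⁻ˢ)`, and
by symmetry equality holds.

The quantum group input is algebraic and uses no Haar state. The condition `ρ ∈ Mor(W, Wᶜᶜ)` says
that the functional `Tr(ρ ·)` is invariant under `Y ↦ W (Y ⊗ 1) W⋆`, and `Tr(ρ⁻¹ ·)` under `Y ↦ W⋆
(Y ⊗ 1) W` (`IsModular.trace_amp_conj`, `IsModular.trace_amp_conj'`). Three facts follow: invariant
subspaces have invariant complements, because the first functional is faithful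
(`IsModular.mem_mor_of_invariant`); partial traces with these weights send intertwiners to
intertwiners, so the trace condition passes to tensor products (`IsModular.tensor`); and, with the
trace condition, `ρ` commutes with `End(W)` (`IsModular.mul_comm_of_mem_mor`), so it can be cut down
to each component. -/

/-- Two finite families of numbers with the same power sums agree up to order. -/
theorem Multiset.map_univ_eq_of_sum_pow_eq {ι : Type*} [Fintype ι] {f g : ι → ℝ}
    (h : ∀ s : ℕ, ∑ i, f i ^ s = ∑ i, g i ^ s) :
    Multiset.map f Finset.univ.val = Multiset.map g Finset.univ.val := by
  have hq : ∀ q : Polynomial ℝ, ∑ i, q.eval (f i) = ∑ i, q.eval (g i) := fun q => by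
    simp only [Polynomial.eval_eq_sum_range]
    rw [Finset.sum_comm, Finset.sum_comm (s := Finset.univ)]
    exact Finset.sum_congr rfl fun k _ => by rw [← Finset.mul_sum, ← Finset.mul_sum, h]
  ext x
  -- On the finite set of all values involved, the Lagrange basis polynomial at `x` is the indicator
  -- of `x`, so its sum over a family is the multiplicity of `x`.
  let S : Finset ℝ := insert x (Finset.univ.image f ∪ Finset.univ.image g)
  have hS : ∀ y ∈ S, (Lagrange.basis S id x).eval y = if x = y then 1 else 0 := fun y hy => by
    split_ifs with hxy
    · subst hxy
      exact Lagrange.eval_basis_self Function.injective_id.injOn hy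
    · exact Lagrange.eval_basis_of_ne (v := id) hxy hy
  have hx := hq (Lagrange.basis S id x)
  rw [Finset.sum_congr rfl fun i _ => hS (f i) (by simp [S]),
    Finset.sum_congr rfl fun i _ => hS (g i) (by simp [S]), Finset.sum_boole, Finset.sum_boole,
    Nat.cast_inj] at hx
  rw [Multiset.count_map, Multiset.count_map]
  exact hx

/-! ### Traces of powers of positive matrices -/

namespace Matrix

variable {ι : Type*} [Fintype ι] [DecidableEq ι]

theorem IsHermitian.trace_pow {R : Matrix ι ι ℂ} (hR : R.IsHermitian) (s : ℕ) :
    (R ^ s).trace = ∑ i, ((hR.eigenvalues i ^ s : ℝ) : ℂ) := by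
  conv_lhs => rw [hR.spectral_theorem, ← map_pow, Unitary.conjStarAlgAut_apply, Matrix.mul_assoc,
    Matrix.trace_mul_comm, Matrix.mul_assoc, Unitary.coe_star_mul_self, Matrix.mul_one,
    Matrix.diagonal_pow]
  simp [Matrix.trace]

theorem PosDef.inv_eq_conjStarAlgAut {R : Matrix ι ι ℂ} (hR : R.PosDef) :
    R⁻¹ = Unitary.conjStarAlgAut ℂ _ hR.isHermitian.eigenvectorUnitary
      (diagonal fun i => (((hR.isHermitian.eigenvalues i)⁻¹ : ℝ) : ℂ)) := by
  refine Matrix.inv_eq_left_inv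
    ((congrArg (_ * ·) hR.isHermitian.spectral_theorem).trans ?_)
  rw [← map_mul, Matrix.diagonal_mul_diagonal, ← map_one (Unitary.conjStarAlgAut ℂ _ _),
    ← Matrix.diagonal_one]
  congr 2
  funext i
  have := (hR.eigenvalues_pos i).ne'
  simp only [Function.comp_apply]
  rw [RCLike.ofReal_eq_complex_ofReal, ← Complex.ofReal_mul, inv_mul_cancel₀ this,
    Complex.ofReal_one]

theorem PosDef.trace_inv_pow {R : Matrix ι ι ℂ} (hR : R.PosDef) (s : ℕ) :
    (R⁻¹ ^ s).trace = ∑ i, (((hR.isHermitian.eigenvalues i)⁻¹ ^ s : ℝ) : ℂ) := by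
  rw [hR.inv_eq_conjStarAlgAut, ← map_pow, Unitary.conjStarAlgAut_apply, Matrix.mul_assoc,
    Matrix.trace_mul_comm, Matrix.mul_assoc, Unitary.coe_star_mul_self, Matrix.mul_one,
    Matrix.diagonal_pow]
  simp [Matrix.trace]

/-- Every eigenvalue is at most `Tr R = Tr R⁻¹`, and the power mean inequality bounds `(Tr R⁻¹)^s`
by `card^(s-1) Tr(R⁻ˢ)`. The number of eigenvalues contributes the last factor `card`. -/
theorem PosDef.re_trace_pow_le {R : Matrix ι ι ℂ} (hR : R.PosDef)
    (h : R.trace = R⁻¹.trace) {s : ℕ} (hs : s ≠ 0) :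
    (R ^ s).trace.re ≤ (Fintype.card ι : ℝ) ^ s * (R⁻¹ ^ s).trace.re := by
  set l := hR.isHermitian.eigenvalues
  have hl : ∀ i, 0 < l i := hR.eigenvalues_pos
  have h1 : ∑ i, l i = ∑ i, (l i)⁻¹ := by
    have e1 := hR.isHermitian.trace_pow 1
    have e2 := hR.trace_inv_pow 1
    rw [pow_one] at e1 e2
    rw [e1, e2, ← Complex.ofReal_sum, ← Complex.ofReal_sum, Complex.ofReal_inj] at h
    simpa using h
  rw [hR.isHermitian.trace_pow, hR.trace_inv_pow, ← Complex.ofReal_sum, ← Complex.ofReal_sum,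
    Complex.ofReal_re, Complex.ofReal_re]
  obtain ⟨t, rfl⟩ := Nat.exists_eq_succ_of_ne_zero hs
  rcases isEmpty_or_nonempty ι with hι | hι
  · simp
  have hc : (0 : ℝ) < Fintype.card ι := by exact_mod_cast Fintype.card_pos
  have h2 : (∑ i, (l i)⁻¹) ^ (t + 1) ≤ (Fintype.card ι : ℝ) ^ t * ∑ i, (l i)⁻¹ ^ (t + 1) := by
    have := pow_sum_div_card_le_sum_pow (s := Finset.univ) (f := fun i => (l i)⁻¹)
      (fun i _ => (inv_pos.2 (hl i)).le) t
    rw [div_le_iff₀ (by simpa using pow_pos hc t)] at this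
    simpa [mul_comm] using this
  calc ∑ i, l i ^ (t + 1) ≤ ∑ _i : ι, (∑ j, (l j)⁻¹) ^ (t + 1) := by
        refine Finset.sum_le_sum fun i _ => pow_le_pow_left₀ (hl i).le ?_ _
        rw [← h1]
        exact Finset.single_le_sum (fun j _ => (hl j).le) (Finset.mem_univ i)
    _ = Fintype.card ι * (∑ j, (l j)⁻¹) ^ (t + 1) := by simp
    _ ≤ Fintype.card ι * ((Fintype.card ι : ℝ) ^ t * ∑ i, (l i)⁻¹ ^ (t + 1)) := by gcongr
    _ = _ := by rw [pow_succ]; ring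

theorem PosDef.re_trace_pow_pos [Nonempty ι] {R : Matrix ι ι ℂ} (hR : R.PosDef) (s : ℕ) :
    0 < (R ^ s).trace.re := by
  rw [hR.isHermitian.trace_pow, ← Complex.ofReal_sum, Complex.ofReal_re]
  exact Finset.sum_pos (fun i _ => pow_pos (hR.eigenvalues_pos i) s) Finset.univ_nonempty

theorem PosDef.re_trace_pow_nonneg {R : Matrix ι ι ℂ} (hR : R.PosDef) (s : ℕ) :
    0 ≤ (R ^ s).trace.re := by
  rw [hR.isHermitian.trace_pow, ← Complex.ofReal_sum, Complex.ofReal_re]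
  exact Finset.sum_nonneg fun i _ => pow_nonneg (hR.eigenvalues_pos i).le s

theorem PosDef.ofReal_re_trace_pow {R : Matrix ι ι ℂ} (hR : R.PosDef) (s : ℕ) :
    (((R ^ s).trace.re : ℝ) : ℂ) = (R ^ s).trace := by
  rw [hR.isHermitian.trace_pow, ← Complex.ofReal_sum, Complex.ofReal_re]

/-- Traces of powers are power sums of the eigenvalues. They fix the multiset of roots of the
characteristic polynomial, and `eigenvalues₀` is that multiset sorted. -/
theorem IsHermitian.eigenvalues₀_eq_of_trace_pow_eq {R S : Matrix ι ι ℂ} (hR : R.IsHermitian)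
    (hS : S.IsHermitian) (h : ∀ s : ℕ, (R ^ s).trace = (S ^ s).trace) :
    hR.eigenvalues₀ = hS.eigenvalues₀ := by
  have hc : R.charpoly.roots = S.charpoly.roots := by
    rw [hR.roots_charpoly_eq_eigenvalues, hS.roots_charpoly_eq_eigenvalues, ← Multiset.map_map,
      ← Multiset.map_map]
    congr 1
    refine Multiset.map_univ_eq_of_sum_pow_eq fun s => ?_
    have := h s
    rw [hR.trace_pow, hS.trace_pow] at this
    exact_mod_cast this
  rw [← List.ofFn_inj, ← hR.sort_roots_charpoly_eq_eigenvalues₀,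
    ← hS.sort_roots_charpoly_eq_eigenvalues₀, hc]

/-- The range of a projection of matrices is parametrized by an isometry. -/
theorem _root_.IsStarProjection.exists_isometry {ι : Type} [Fintype ι] [DecidableEq ι]
    {p : Matrix ι ι ℂ} (hp : IsStarProjection p) :
    ∃ (r : ℕ) (V : Matrix ι (Fin r) ℂ), Vᴴ * V = 1 ∧ V * Vᴴ = p := by
  have hH : p.IsHermitian := hp.isSelfAdjoint
  set U : Matrix ι ι ℂ := hH.eigenvectorUnitary.1
  set l := hH.eigenvalues
  have hU : Uᴴ * U = 1 := Unitary.coe_star_mul_self _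
  have hU' : U * Uᴴ = 1 := Unitary.coe_mul_star_self _
  have hpU : p = U * diagonal (fun i => (l i : ℂ)) * Uᴴ := by
    have := hH.spectral_theorem
    rwa [Unitary.conjStarAlgAut_apply] at this
  have hl : ∀ i, l i = 0 ∨ l i = 1 := fun i => by
    have h1 : diagonal (fun i => (l i : ℂ)) = Uᴴ * p * U := by
      rw [hpU, ← Matrix.mul_assoc, ← Matrix.mul_assoc, hU, Matrix.one_mul, Matrix.mul_assoc, hU,
        Matrix.mul_one]
    have h2 : diagonal (fun i => (l i : ℂ)) * diagonal (fun i => (l i : ℂ)) =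
        diagonal (fun i => (l i : ℂ)) := by
      rw [h1]
      calc Uᴴ * p * U * (Uᴴ * p * U) = Uᴴ * p * (U * Uᴴ) * p * U := by
            simp only [Matrix.mul_assoc]
        _ = Uᴴ * (p * p) * U := by rw [hU', Matrix.mul_one, Matrix.mul_assoc Uᴴ]
        _ = _ := by rw [hp.isIdempotentElem.eq]
    have h3 := congrFun₂ h2 i i
    rw [Matrix.diagonal_mul_diagonal, Matrix.diagonal_apply_eq, Matrix.diagonal_apply_eq,
      ← Complex.ofReal_mul, Complex.ofReal_inj] at h3
    rcases eq_or_ne (l i) 0 with h | h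
    · exact Or.inl h
    · exact Or.inr (mul_left_cancel₀ h (by rw [h3, mul_one]))
  let e := (Fintype.equivFin {i // l i = 1}).symm
  -- The columns of the isometry are the eigenvectors with eigenvalue `1`.
  refine ⟨_, U.submatrix id fun k => (e k : ι), ?_, ?_⟩
  · ext a b
    have := congrFun₂ hU (e a) (e b)
    rw [Matrix.mul_apply] at this ⊢
    simp only [conjTranspose_apply, submatrix_apply, id] at this ⊢
    rw [this, Matrix.one_apply, Matrix.one_apply]
    simp [Subtype.val_inj]
  · ext a b
    rw [hpU, Matrix.mul_apply, Matrix.mul_apply]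
    simp only [conjTranspose_apply, submatrix_apply, id, Matrix.mul_diagonal]
    rw [e.sum_comp fun x : {i // l i = 1} => U a x * star (U b x),
      ← Finset.sum_subtype (Finset.univ.filter fun i => l i = 1) (by simp)
        fun x => U a x * star (U b x), Finset.sum_filter]
    refine Finset.sum_congr rfl fun i _ => ?_
    rcases hl i with h | h <;> simp [h]

end Matrix

/-! ### Faithfulness and commutation for positive definite matrices -/

namespace Matrix.PosDef

variable {ι : Type*} [Fintype ι] [DecidableEq ι] {ρ : Matrix ι ι ℂ}

theorem inv_mul_cancel (h : ρ.PosDef) : ρ⁻¹ * ρ = 1 :=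
  Matrix.nonsing_inv_mul _ ((Matrix.isUnit_iff_isUnit_det _).1 h.isUnit)

theorem mul_inv_cancel (h : ρ.PosDef) : ρ * ρ⁻¹ = 1 :=
  Matrix.mul_nonsing_inv _ ((Matrix.isUnit_iff_isUnit_det _).1 h.isUnit)

open scoped MatrixOrder in
theorem exists_conjTranspose_mul_self (h : ρ.PosDef) : ∃ s : Matrix ι ι ℂ, ρ = s.conjTranspose * s :=
  CStarAlgebra.nonneg_iff_eq_star_mul_self.1 h.posSemidef.nonneg

theorem eq_zero_of_trace_conjTranspose_mul_mul {κ : Type*} [Fintype κ] (h : ρ.PosDef)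
    {K : Matrix ι κ ℂ} (hK : (K.conjTranspose * (ρ * K)).trace = 0) : K = 0 := by
  obtain ⟨s, hs⟩ := h.exists_conjTranspose_mul_self
  have h1 : s * K = 0 := by
    rw [← Matrix.trace_conjTranspose_mul_self_eq_zero_iff, Matrix.conjTranspose_mul,
      Matrix.mul_assoc, ← Matrix.mul_assoc _ s K, ← hs]
    exact hK
  calc K = ρ⁻¹ * (s.conjTranspose * (s * K)) := by
        rw [← Matrix.mul_assoc _ s K, ← hs, ← Matrix.mul_assoc, h.inv_mul_cancel, Matrix.one_mul]
    _ = 0 := by rw [h1, Matrix.mul_zero, Matrix.mul_zero]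

/-- A matrix that commutes with the square of a positive definite matrix commutes with the
matrix itself. -/
theorem commute_of_mul_self (h : ρ.PosDef) {T : Matrix ι ι ℂ} (hT : ρ * ρ * T = T * (ρ * ρ)) :
    ρ * T = T * ρ := by
  set K := ρ * T - T * ρ with hK
  -- The commutator `K = [ρ, T]` satisfies `ρK + Kρ = [ρ², T] = 0`. Hence `Tr(K⋆ρK)` is minus the
  -- nonnegative number `Tr(KρK⋆)`, so both vanish.
  have h1 : ρ * K = -(K * ρ) := by
    rw [hK, Matrix.mul_sub, Matrix.sub_mul, ← Matrix.mul_assoc, hT]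
    simp only [Matrix.mul_assoc]
    abel
  have e : (K.conjTranspose * (ρ * K)).trace = -(K * (ρ * K.conjTranspose)).trace := by
    rw [h1, Matrix.mul_neg, Matrix.trace_neg, Matrix.trace_mul_comm, Matrix.mul_assoc]
  have p1 : 0 ≤ (K.conjTranspose * (ρ * K)).trace := by
    rw [← Matrix.mul_assoc]
    exact (h.posSemidef.conjTranspose_mul_mul_same K).trace_nonneg
  have p2 : 0 ≤ (K * (ρ * K.conjTranspose)).trace := by
    rw [← Matrix.mul_assoc]
    exact (h.posSemidef.mul_mul_conjTranspose_same K).trace_nonneg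
  have h0 : K = 0 := h.eq_zero_of_trace_conjTranspose_mul_mul
    (le_antisymm (e ▸ neg_nonpos.2 p2) p1)
  exact sub_eq_zero.1 h0

end Matrix.PosDef

namespace CQG

/-! ### Scalar matrices inside matrices over a C*-algebra -/

section Amp

variable {A : Type u} [CStarAlgebra A] {ι κ μ : Type}

theorem amp_apply (T : Matrix κ ι ℂ) (i : κ) (j : ι) : amp A T i j = algebraMap ℂ A (T i j) := rfl

theorem amp_mul [Fintype κ] (S : Matrix μ κ ℂ) (T : Matrix κ ι ℂ) : amp A (S * T) = amp A S * amp A T :=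
  Matrix.map_mul

theorem amp_one [DecidableEq ι] : amp A (1 : Matrix ι ι ℂ) = 1 :=
  Matrix.map_one _ (map_zero _) (map_one _)

theorem amp_conjTranspose (T : Matrix κ ι ℂ) :
    amp A T.conjTranspose = (amp A T).conjTranspose := by
  ext i j
  exact algebraMap_star_comm (R := ℂ) (A := A) (T j i)

theorem transpose_amp_mul [Fintype κ] (T : Matrix μ κ ℂ) (M : Matrix κ ι A) :
    (amp A T * M).transpose = M.transpose * amp A T.transpose := by
  ext i j
  simp only [Matrix.transpose_apply, Matrix.mul_apply, amp_apply]
  exact Finset.sum_congr rfl fun k _ => Algebra.commutes _ _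

theorem transpose_mul_amp [Fintype κ] (M : Matrix μ κ A) (T : Matrix κ ι ℂ) :
    (M * amp A T).transpose = amp A T.transpose * M.transpose := by
  ext i j
  simp only [Matrix.transpose_apply, Matrix.mul_apply, amp_apply]
  exact Finset.sum_congr rfl fun k _ => (Algebra.commutes _ _).symm

theorem map_star_mul_amp [Fintype κ] (M : Matrix μ κ A) (T : Matrix κ ι ℂ) :
    (M * amp A T).map star = M.map star * amp A (T.map star) := by
  ext i j
  simp only [Matrix.map_apply, Matrix.mul_apply, amp_apply, star_sum, star_mul,
    ← algebraMap_star_comm]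
  exact Finset.sum_congr rfl fun k _ => Algebra.commutes _ _

theorem map_star_amp_mul [Fintype κ] (T : Matrix μ κ ℂ) (M : Matrix κ ι A) :
    (amp A T * M).map star = amp A (T.map star) * M.map star := by
  ext i j
  simp only [Matrix.map_apply, Matrix.mul_apply, amp_apply, star_sum, star_mul,
    ← algebraMap_star_comm]
  exact Finset.sum_congr rfl fun k _ => (Algebra.commutes _ _).symm

/-- The trace over a noncommutative algebra is not cyclic in general; it is here because the entries
of one factor are central scalars. -/
theorem trace_amp_mul [Fintype ι] [Fintype κ] (T : Matrix ι κ ℂ) (M : Matrix κ ι A) :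
    (amp A T * M).trace = (M * amp A T).trace := by
  simp only [Matrix.trace, Matrix.diag_apply, Matrix.mul_apply, amp_apply]
  rw [Finset.sum_comm]
  exact Finset.sum_congr rfl fun k _ => Finset.sum_congr rfl fun l _ => Algebra.commutes _ _

theorem trace_mul_eq_sum [Fintype ι] [Fintype κ] (S : Matrix κ ι ℂ) (T : Matrix ι κ ℂ) :
    (S * T).trace = ∑ k, ∑ l, T k l * S l k := by
  rw [Matrix.trace_mul_comm]
  rfl

/-- Collects the coefficient of each entry of `Y`, so that invariance of a weighted trace reduces to
the entrywise identities `left_iff` and `right_iff`. -/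
theorem trace_amp_mul_amp [Fintype ι] (S Y : Matrix ι ι ℂ) (M N : Matrix ι ι A) :
    (amp A S * (M * amp A Y * N)).trace =
      ∑ k, ∑ l, Y k l • ∑ i, ∑ j, S j i • (M i k * N l j) := by
  calc _ = ∑ j, ∑ i, ∑ l, ∑ k, Y k l • S j i • (M i k * N l j) := by
        simp only [Matrix.trace, Matrix.diag_apply, Matrix.mul_apply, amp_apply,
          Finset.mul_sum, Finset.sum_mul, Algebra.smul_def]
        refine Finset.sum_congr rfl fun j _ => Finset.sum_congr rfl fun i _ =>
          Finset.sum_congr rfl fun l _ => Finset.sum_congr rfl fun k _ => ?_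
        rw [← Algebra.commutes (Y k l) (M i k), mul_assoc (algebraMap ℂ A (Y k l)),
          ← mul_assoc, ← mul_assoc, ← mul_assoc, ← mul_assoc, ← map_mul, ← map_mul,
          mul_comm (S j i)]
    _ = ∑ p : ι × ι, ∑ q : ι × ι, Y q.2 q.1 • S p.1 p.2 • (M p.2 q.2 * N q.1 p.1) := by
        simp only [Fintype.sum_prod_type]
    _ = ∑ q : ι × ι, ∑ p : ι × ι, Y q.2 q.1 • S p.1 p.2 • (M p.2 q.2 * N q.1 p.1) :=
        Finset.sum_comm
    _ = ∑ l, ∑ k, Y k l • ∑ j, ∑ i, S j i • (M i k * N l j) := by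
        simp only [Fintype.sum_prod_type, Finset.smul_sum]
    _ = _ := by
        rw [Finset.sum_comm]
        refine Finset.sum_congr rfl fun k _ => Finset.sum_congr rfl fun l _ => ?_
        rw [Finset.sum_comm]

theorem trace_amp [Fintype ι] (T : Matrix ι ι ℂ) : (amp A T).trace = algebraMap ℂ A T.trace := by
  simp only [Matrix.trace, Matrix.diag_apply, amp_apply, map_sum]

/-- `(Tr ⊗ id)(M M⋆) = 0` only if `M = 0`. -/
theorem eq_zero_of_trace_mul_conjTranspose [Fintype ι] [Fintype κ] {M : Matrix κ ι A}
    (h : (M * M.conjTranspose).trace = 0) : M = 0 := by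
  let _ := CStarAlgebra.spectralOrder A
  have _ := CStarAlgebra.spectralOrderedRing A
  replace h : ∑ i, ∑ j, M i j * star (M i j) = 0 := h
  have h0 : ∀ i, 0 ≤ ∑ j, M i j * star (M i j) := fun i =>
    Finset.sum_nonneg fun j _ => mul_star_self_nonneg _
  ext i j
  have h1 := (Finset.sum_eq_zero_iff_of_nonneg fun i _ => h0 i).1 h i (Finset.mem_univ i)
  have h2 := (Finset.sum_eq_zero_iff_of_nonneg fun j _ => mul_star_self_nonneg (M i j)).1 h1 j
    (Finset.mem_univ j)
  exact (CStarRing.mul_star_self_eq_zero_iff _).1 h2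

end Amp

/-! ### Invariant weights, complete reducibility and the commutant -/

section Modular

variable {A : Type u} [CStarAlgebra A]

theorem left_iff {ι : Type} [Fintype ι] {W : Matrix ι ι A} {ρ : Matrix ι ι ℂ} :
    (amp A ρ * W).transpose * W.map star = amp A ρ.transpose ↔
      ∀ k l, ∑ i, ∑ j, ρ j i • (W i k * star (W j l)) = algebraMap ℂ A (ρ l k) := by
  rw [← Matrix.ext_iff]
  refine forall₂_congr fun k l => ?_
  rw [Finset.sum_comm]
  simp only [Matrix.mul_apply, Matrix.transpose_apply, amp_apply, Matrix.map_apply,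
    Finset.sum_mul, Algebra.smul_def, mul_assoc]

theorem right_iff {ι : Type} [Fintype ι] {W : Matrix ι ι A} {σ : Matrix ι ι ℂ} :
    W.map star * (W * amp A σ).transpose = amp A σ.transpose ↔
      ∀ k l, ∑ i, ∑ j, σ j i • (star (W k i) * W l j) = algebraMap ℂ A (σ l k) := by
  rw [← Matrix.ext_iff]
  refine forall₂_congr fun k l => ?_
  simp only [Matrix.mul_apply, Matrix.transpose_apply, amp_apply, Matrix.map_apply,
    Finset.mul_sum, Algebra.smul_def, ← mul_assoc]
  simp only [Algebra.commutes, mul_assoc]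

theorem mul_eq_of_mem_mor {ι : Type} [Fintype ι] {W : Matrix ι ι A} {T : Matrix ι ι ℂ}
    (h : T ∈ Mor W W) : W * amp A T = amp A T * W := h

theorem mul_mem_mor {ι : Type} [Fintype ι] {W : Matrix ι ι A} {S T : Matrix ι ι ℂ} (hS : S ∈ Mor W W)
    (hT : T ∈ Mor W W) : S * T ∈ Mor W W := by
  change W * amp A (S * T) = amp A (S * T) * W
  rw [amp_mul, ← Matrix.mul_assoc, mul_eq_of_mem_mor hS, Matrix.mul_assoc, mul_eq_of_mem_mor hT,
    Matrix.mul_assoc]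

theorem sub_mem_mor {ι : Type} [Fintype ι] {W : Matrix ι ι A} {S T : Matrix ι ι ℂ} (hS : S ∈ Mor W W)
    (hT : T ∈ Mor W W) : S - T ∈ Mor W W := by
  have e : amp A (S - T) = amp A S - amp A T := Matrix.map_sub _ (map_sub _) _ _
  change W * amp A (S - T) = amp A (S - T) * W
  rw [e, Matrix.mul_sub, Matrix.sub_mul, mul_eq_of_mem_mor hS, mul_eq_of_mem_mor hT]

variable {ι : Type} [Fintype ι] [DecidableEq ι]

/-- The properties of `ρ = ρ_W` for a unitary representation `W` that pass to tensor products. The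
fields `left` and `right` say that `(ρ W ρ⁻¹)ᵀ` is a left and right inverse of the contragredient
`W.map star`. -/
structure IsModular (W : Matrix ι ι A) (ρ : Matrix ι ι ℂ) : Prop where
  mem_unitary : W ∈ unitary (Matrix ι ι A)
  posDef : ρ.PosDef
  left : (amp A ρ * W).transpose * W.map star = amp A ρ.transpose
  right : W.map star * (W * amp A ρ⁻¹).transpose = amp A ρ⁻¹.transpose
  trace_eq : ∀ T ∈ Mor W W, (T * ρ).trace = (T * ρ⁻¹).trace

theorem unitary_star_mul {W : Matrix ι ι A} (h : W ∈ unitary (Matrix ι ι A)) :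
    W.conjTranspose * W = 1 := (Unitary.mem_iff.1 h).1

theorem unitary_mul_star {W : Matrix ι ι A} (h : W ∈ unitary (Matrix ι ι A)) :
    W * W.conjTranspose = 1 := (Unitary.mem_iff.1 h).2

theorem conjTranspose_mem_mor {W : Matrix ι ι A} (hW : W ∈ unitary (Matrix ι ι A))
    {T : Matrix ι ι ℂ} (h : T ∈ Mor W W) : T.conjTranspose ∈ Mor W W := by
  have h1 : amp A T * W.conjTranspose = W.conjTranspose * amp A T := by
    calc amp A T * W.conjTranspose
        = W.conjTranspose * W * (amp A T * W.conjTranspose) := by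
          rw [unitary_star_mul hW, Matrix.one_mul]
      _ = W.conjTranspose * (W * amp A T) * W.conjTranspose := by simp only [Matrix.mul_assoc]
      _ = W.conjTranspose * amp A T * (W * W.conjTranspose) := by
          rw [mul_eq_of_mem_mor h]; simp only [Matrix.mul_assoc]
      _ = _ := by rw [unitary_mul_star hW, Matrix.mul_one]
  have h2 := congrArg Matrix.conjTranspose h1
  rw [Matrix.conjTranspose_mul, Matrix.conjTranspose_mul, Matrix.conjTranspose_conjTranspose,
    ← amp_conjTranspose] at h2
  exact h2

theorem one_mem_mor {W : Matrix ι ι A} : (1 : Matrix ι ι ℂ) ∈ Mor W W := by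
  change W * amp A 1 = amp A 1 * W
  rw [amp_one, Matrix.one_mul, Matrix.mul_one]

namespace IsModular

variable {W : Matrix ι ι A} {ρ : Matrix ι ι ℂ}

/-- This is the invariance of the functional `Tr(ρ ·)` under the adjoint action of `W`; `left`
states it on matrix units. It replaces averaging over the group. -/
theorem trace_amp_conj (h : IsModular W ρ) (Y : Matrix ι ι ℂ) :
    (amp A ρ * (W * amp A Y * W.conjTranspose)).trace = algebraMap ℂ A (ρ * Y).trace := by
  rw [trace_amp_mul_amp, trace_mul_eq_sum, map_sum]
  refine Finset.sum_congr rfl fun k _ => ?_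
  rw [map_sum]
  refine Finset.sum_congr rfl fun l _ => ?_
  rw [map_mul, ← left_iff.1 h.left k l, Algebra.smul_def]
  rfl

theorem trace_amp_conj' (h : IsModular W ρ) (Y : Matrix ι ι ℂ) :
    (amp A ρ⁻¹ * (W.conjTranspose * amp A Y * W)).trace = algebraMap ℂ A (ρ⁻¹ * Y).trace := by
  rw [trace_amp_mul_amp, trace_mul_eq_sum, map_sum]
  refine Finset.sum_congr rfl fun k _ => ?_
  rw [map_sum]
  refine Finset.sum_congr rfl fun l _ => ?_
  rw [map_mul, ← right_iff.1 h.right k l, Algebra.smul_def]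
  rfl

/-- Complete reducibility: invariant subspaces have invariant orthogonal complements. -/
theorem mem_mor_of_invariant (h : IsModular W ρ) {e : Matrix ι ι ℂ} (he : IsStarProjection e)
    (hWe : W * amp A e = amp A e * W * amp A e) : e ∈ Mor W W := by
  set E := amp A e with hE
  have hEE : E * E = E := by rw [hE, ← amp_mul, he.isIdempotentElem.eq]
  have hEs : E.conjTranspose = E := by
    rw [hE, ← amp_conjTranspose]; exact congrArg _ he.isSelfAdjoint
  set b := E * W * (1 - E) with hb
  have hX : W * E * W.conjTranspose * E = W * E * W.conjTranspose := by
    have h1 : E * (W * E * W.conjTranspose) = W * E * W.conjTranspose := by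
      rw [← Matrix.mul_assoc, ← Matrix.mul_assoc, ← hWe]
    have h2 := congrArg Matrix.conjTranspose h1
    simpa only [Matrix.conjTranspose_mul, Matrix.conjTranspose_conjTranspose, hEs,
      Matrix.mul_assoc] using h2
  -- The off-diagonal corner `b` measures the failure of `E` to commute with `W`. Its square is a
  -- difference of `E` and a conjugate of `E`, which the invariant weight does not distinguish;
  -- faithfulness then forces `b = 0`.
  have hbb : b * b.conjTranspose = E - W * E * W.conjTranspose := by
    have h1 : (1 - E).conjTranspose = 1 - E := by
      rw [Matrix.conjTranspose_sub, hEs, Matrix.conjTranspose_one]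
    have h2 : (1 - E) * (1 - E) = 1 - E := by
      
      rw [Matrix.mul_sub, Matrix.mul_one, Matrix.sub_mul, Matrix.one_mul, hEE, sub_self, sub_zero]
    calc b * b.conjTranspose = E * W * ((1 - E) * (1 - E)) * (W.conjTranspose * E) := by
          rw [hb, Matrix.conjTranspose_mul, Matrix.conjTranspose_mul, h1, hEs]
          simp only [Matrix.mul_assoc]
      _ = E * (W * W.conjTranspose) * E - (E * W * E) * W.conjTranspose * E := by
          rw [h2]
          simp only [Matrix.mul_sub, Matrix.sub_mul, Matrix.mul_assoc, Matrix.mul_one]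
      _ = _ := by rw [unitary_mul_star h.mem_unitary, Matrix.mul_one, hEE, ← hWe, hX]
  have htr : (amp A ρ * (b * b.conjTranspose)).trace = 0 := by
    rw [hbb, Matrix.mul_sub, Matrix.trace_sub, h.trace_amp_conj, hE, ← amp_mul, trace_amp, sub_self]
  obtain ⟨s, hs⟩ := h.posDef.exists_conjTranspose_mul_self
  have hsb : amp A s * b = 0 := by
    refine eq_zero_of_trace_mul_conjTranspose ?_
    rw [Matrix.conjTranspose_mul, ← amp_conjTranspose, ← Matrix.mul_assoc, ← trace_amp_mul,
      ← htr, hs, amp_mul]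
    simp only [Matrix.mul_assoc]
  have hb0 : b = 0 := by
    calc b = amp A (ρ⁻¹ * ρ) * b := by rw [h.posDef.inv_mul_cancel, amp_one, Matrix.one_mul]
      _ = amp A ρ⁻¹ * (amp A s.conjTranspose * (amp A s * b)) := by
          rw [← Matrix.mul_assoc (amp A s.conjTranspose), ← amp_mul, ← hs, amp_mul,
            Matrix.mul_assoc (amp A ρ⁻¹)]
      _ = 0 := by rw [hsb, Matrix.mul_zero, Matrix.mul_zero]
  change W * E = E * W
  rw [hb, Matrix.mul_sub, Matrix.mul_one, ← hWe] at hb0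
  exact (sub_eq_zero.1 hb0).symm

/-- Since `T⋆` commutes with `W`, the entrywise conjugate of `T⋆`, which is `Tᵀ`, commutes with
`W.map star` and hence with its inverse `(ρWρ⁻¹)ᵀ`. Transposing, `T` commutes with `ρWρ⁻¹`. -/
theorem inv_mul_mul_mem_mor (h : IsModular W ρ) {T : Matrix ι ι ℂ} (hT : T ∈ Mor W W) :
    ρ⁻¹ * T * ρ ∈ Mor W W := by
  set S := T.conjTranspose with hS
  set C := W.map star
  have hSC : C * amp A (S.map star) = amp A (S.map star) * C := by
    rw [← map_star_mul_amp, ← map_star_amp_mul,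
      mul_eq_of_mem_mor (conjTranspose_mem_mor h.mem_unitary hT)]
  have hST : (S.map star).transpose = T := by rw [hS]; exact Matrix.conjTranspose_conjTranspose T
  have hρ : ρ⁻¹.transpose * ρ.transpose = 1 := by
    rw [← Matrix.transpose_mul, h.posDef.mul_inv_cancel, Matrix.transpose_one]
  set D := S.map star
  have e1 : (amp A ρ * W).transpose * amp A D =
      amp A (ρ.transpose * D * ρ⁻¹.transpose) * (amp A ρ * W).transpose := by
    have e : (amp A ρ * W).transpose * amp A D * C =
        amp A (ρ.transpose * D * ρ⁻¹.transpose) * (amp A ρ * W).transpose * C := by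
      rw [Matrix.mul_assoc, ← hSC, ← Matrix.mul_assoc, h.left, Matrix.mul_assoc, h.left, ← amp_mul,
        ← amp_mul, Matrix.mul_assoc _ ρ⁻¹.transpose, hρ, Matrix.mul_one]
    -- A right inverse of `C`, used to cancel `C` from `e`.
    have hC : C * ((W * amp A ρ⁻¹).transpose * amp A ρ.transpose) = 1 := by
      rw [← Matrix.mul_assoc, h.right, ← amp_mul, hρ, amp_one]
    have e' := congrArg (· * ((W * amp A ρ⁻¹).transpose * amp A ρ.transpose)) e
    simpa only [Matrix.mul_assoc _ C, hC, Matrix.mul_one] using e'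
  have e2 := congrArg Matrix.transpose e1
  rw [transpose_mul_amp, transpose_amp_mul (ρ.transpose * D * ρ⁻¹.transpose),
    Matrix.transpose_transpose, hST] at e2
  simp only [Matrix.transpose_mul, Matrix.transpose_transpose, hST] at e2
  have e3 := congrArg (amp A ρ⁻¹ * ·) e2
  simp only [← Matrix.mul_assoc, ← amp_mul, h.posDef.inv_mul_cancel, amp_one,
    Matrix.one_mul] at e3
  exact e3.symm

theorem mul_mul_inv_mem_mor (h : IsModular W ρ) {T : Matrix ι ι ℂ} (hT : T ∈ Mor W W) :
    ρ * T * ρ⁻¹ ∈ Mor W W := by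
  have := conjTranspose_mem_mor h.mem_unitary
    (h.inv_mul_mul_mem_mor (conjTranspose_mem_mor h.mem_unitary hT))
  rwa [Matrix.conjTranspose_mul, Matrix.conjTranspose_mul, Matrix.conjTranspose_conjTranspose,
    h.posDef.isHermitian.eq, h.posDef.inv.isHermitian.eq, ← Matrix.mul_assoc] at this

/-- Both `ρTρ⁻¹` and `ρ⁻¹Tρ` lie in `End(W)`. The trace condition shows that they have the same
pairing with all of `End(W)`, so they agree; that means `ρ²` commutes with `T`, and positivity lets
one take the square root. -/
theorem mul_comm_of_mem_mor (h : IsModular W ρ) {T : Matrix ι ι ℂ} (hT : T ∈ Mor W W) :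
    ρ * T = T * ρ := by
  refine h.posDef.commute_of_mul_self ?_
  have c1 := h.posDef.inv_mul_cancel
  have c2 := h.posDef.mul_inv_cancel
  set D := ρ * T * ρ⁻¹ - ρ⁻¹ * T * ρ with hD
  have hDm : D ∈ Mor W W := sub_mem_mor (h.mul_mul_inv_mem_mor hT) (h.inv_mul_mul_mem_mor hT)
  -- By cyclicity the two terms are `Tr(TSρ)` and, after the trace condition replaces `ρ` by `ρ⁻¹`,
  -- `Tr(TSρ⁻¹)`. The trace condition for `TS` identifies them.
  have key : ∀ S ∈ Mor W W, (S * D * ρ).trace = 0 := fun S hS => by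
    have e1 : (S * (ρ * T * ρ⁻¹) * ρ).trace = (T * S * ρ).trace := by
      simp only [Matrix.mul_assoc, c1, Matrix.mul_one]
      rw [← Matrix.mul_assoc, Matrix.trace_mul_comm]
    have e2 : (S * (ρ⁻¹ * T * ρ) * ρ⁻¹).trace = (T * S * ρ⁻¹).trace := by
      simp only [Matrix.mul_assoc, c2, Matrix.mul_one]
      rw [← Matrix.mul_assoc, Matrix.trace_mul_comm]
    rw [hD, Matrix.mul_sub, Matrix.sub_mul, Matrix.trace_sub, e1,
      h.trace_eq _ (mul_mem_mor hS (h.inv_mul_mul_mem_mor hT)), e2,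
      h.trace_eq _ (mul_mem_mor hT hS), sub_self]
  have hD0 : D = 0 := by
    -- Testing against `S = D⋆` gives `Tr(DρD⋆) = 0`.
    have k := key _ (conjTranspose_mem_mor h.mem_unitary hDm)
    rw [Matrix.mul_assoc, Matrix.trace_mul_comm, Matrix.mul_assoc] at k
    have k2 : (D.conjTranspose.conjTranspose * (ρ * D.conjTranspose)).trace = 0 := by
      rwa [Matrix.conjTranspose_conjTranspose]
    have := h.posDef.eq_zero_of_trace_conjTranspose_mul_mul k2
    rwa [Matrix.conjTranspose_eq_zero] at this
  have e := sub_eq_zero.1 hD0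
  have e' := congrArg (fun M => ρ * M * ρ) e
  simp only [Matrix.mul_assoc, c1, Matrix.mul_one] at e'
  simpa only [← Matrix.mul_assoc, c2, Matrix.one_mul] using e'

end IsModular

end Modular

open scoped Kronecker

/-! ### Weighted partial traces and tensor products -/

section PartialTrace

variable {A : Type u} [CStarAlgebra A] {ι κ : Type} [Fintype ι] [DecidableEq ι]
  [Fintype κ] [DecidableEq κ]

/-- The weighted partial trace `(id ⊗ Tr)((1 ⊗ σ) T)`. -/
def rightTrace {ι κ : Type} [Fintype κ] (σ : Matrix κ κ ℂ) (T : Matrix (ι × κ) (ι × κ) ℂ) :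
    Matrix ι ι ℂ :=
  fun p q => (σ * Matrix.of fun i j => T (p, i) (q, j)).trace

/-- The weighted partial trace `(Tr ⊗ id)((τ ⊗ 1) T)`. -/
def leftTrace {ι κ : Type} [Fintype ι] (τ : Matrix ι ι ℂ) (T : Matrix (ι × κ) (ι × κ) ℂ) :
    Matrix κ κ ℂ :=
  fun i j => (τ * Matrix.of fun p q => T (p, i) (q, j)).trace

theorem trace_mul_kronecker_eq_right {ι κ : Type} [Fintype ι] [Fintype κ] (τ : Matrix ι ι ℂ)
    (σ : Matrix κ κ ℂ) (T : Matrix (ι × κ) (ι × κ) ℂ) :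
    (T * τ ⊗ₖ σ).trace = (rightTrace σ T * τ).trace := by
  simp only [rightTrace, Matrix.trace, Matrix.diag_apply, Matrix.mul_apply,
    Matrix.kroneckerMap_apply, Fintype.sum_prod_type, Finset.sum_mul, Matrix.of_apply]
  refine Finset.sum_congr rfl fun p _ => ?_
  rw [Finset.sum_comm]
  refine Finset.sum_congr rfl fun q _ => ?_
  rw [Finset.sum_comm]
  refine Finset.sum_congr rfl fun i _ => Finset.sum_congr rfl fun j _ => ?_
  ring

theorem trace_mul_kronecker_eq_left {ι κ : Type} [Fintype ι] [Fintype κ] (τ : Matrix ι ι ℂ)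
    (σ : Matrix κ κ ℂ) (T : Matrix (ι × κ) (ι × κ) ℂ) :
    (T * τ ⊗ₖ σ).trace = (leftTrace τ T * σ).trace := by
  simp only [leftTrace, Matrix.trace, Matrix.diag_apply, Matrix.mul_apply,
    Matrix.kroneckerMap_apply, Fintype.sum_prod_type, Finset.sum_mul, Matrix.of_apply]
  rw [Finset.sum_comm]
  refine Finset.sum_congr rfl fun i _ => ?_
  calc ∑ p, ∑ q, ∑ j, T (p, i) (q, j) * (τ q p * σ j i)
      = ∑ p, ∑ j, ∑ q, T (p, i) (q, j) * (τ q p * σ j i) :=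
        Finset.sum_congr rfl fun p _ => Finset.sum_comm
    _ = ∑ j, ∑ p, ∑ q, T (p, i) (q, j) * (τ q p * σ j i) := Finset.sum_comm
    _ = ∑ j, ∑ q, ∑ p, T (p, i) (q, j) * (τ q p * σ j i) :=
        Finset.sum_congr rfl fun p _ => Finset.sum_comm
    _ = _ := Finset.sum_congr rfl fun j _ => Finset.sum_congr rfl fun q _ =>
        Finset.sum_congr rfl fun p _ => by ring

theorem mem_mor_iff_conj {W : Matrix ι ι A} (hW : W ∈ unitary (Matrix ι ι A))
    {T : Matrix ι ι ℂ} : T ∈ Mor W W ↔ W * amp A T * W.conjTranspose = amp A T := by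
  constructor
  · intro h
    rw [mul_eq_of_mem_mor h, Matrix.mul_assoc, unitary_mul_star hW, Matrix.mul_one]
  · intro h
    change W * amp A T = amp A T * W
    conv_rhs => rw [← h]
    rw [Matrix.mul_assoc _ _ W, unitary_star_mul hW, Matrix.mul_one]

theorem mem_mor_iff_conj' {W : Matrix ι ι A} (hW : W ∈ unitary (Matrix ι ι A))
    {T : Matrix ι ι ℂ} : T ∈ Mor W W ↔ W.conjTranspose * amp A T * W = amp A T := by
  constructor
  · intro h
    rw [Matrix.mul_assoc, ← mul_eq_of_mem_mor h, ← Matrix.mul_assoc, unitary_star_mul hW,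
      Matrix.one_mul]
  · intro h
    change W * amp A T = amp A T * W
    conv_lhs => rw [← h]
    rw [Matrix.mul_assoc, ← Matrix.mul_assoc W, unitary_mul_star hW, Matrix.one_mul]

/-- In `W X (·) X⋆ W⋆` the factor `X` stands next to the argument, so conjugation by `X` can be
carried out first and removed by an invariant weight on the second leg. For the reversed conjugation
below it is `W` that is innermost. -/
theorem tensorMat_conj_apply {ι κ : Type} [Fintype ι] [Fintype κ] (W : Matrix ι ι A) (X : Matrix κ κ A)
    (T : Matrix (ι × κ) (ι × κ) ℂ) (p q : ι) (i j : κ) :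
    (UnitaryRep.tensorMat W X * amp A T * (UnitaryRep.tensorMat W X).conjTranspose) (p, i) (q, j) =
      ∑ s, ∑ r, W p r * (X * amp A (Matrix.of fun k l => T (r, k) (s, l)) * X.conjTranspose) i j *
        star (W q s) := by
  simp only [Matrix.mul_apply, amp_apply, Matrix.conjTranspose_apply, Fintype.sum_prod_type,
    UnitaryRep.tensorMat, Finset.sum_mul, Finset.mul_sum, Matrix.of_apply, star_mul, mul_assoc]
  exact Finset.sum_congr rfl fun s _ => Finset.sum_comm

theorem tensorMat_conj_apply' {ι κ : Type} [Fintype ι] [Fintype κ] (W : Matrix ι ι A) (X : Matrix κ κ A)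
    (T : Matrix (ι × κ) (ι × κ) ℂ) (p q : ι) (i j : κ) :
    ((UnitaryRep.tensorMat W X).conjTranspose * amp A T * UnitaryRep.tensorMat W X) (p, i) (q, j) =
      ∑ l, ∑ k, star (X k i) *
        (W.conjTranspose * amp A (Matrix.of fun r s => T (r, k) (s, l)) * W) p q * X l j := by
  simp only [Matrix.mul_apply, amp_apply, Matrix.conjTranspose_apply, Fintype.sum_prod_type,
    UnitaryRep.tensorMat, Finset.sum_mul, Finset.mul_sum, Matrix.of_apply, star_mul, mul_assoc]
  rw [Finset.sum_comm]
  refine Finset.sum_congr rfl fun l _ => ?_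
  rw [Finset.sum_comm (s := Finset.univ (α := κ))]
  exact Finset.sum_congr rfl fun s _ => Finset.sum_comm

theorem trace_amp_mul_of {κ : Type} [Fintype κ] (σ : Matrix κ κ ℂ) (Z : Matrix κ κ A) (a b : A) :
    (amp A σ * Matrix.of fun i j => a * Z i j * b).trace = a * (amp A σ * Z).trace * b := by
  simp only [Matrix.trace, Matrix.diag_apply, Matrix.mul_apply, Matrix.of_apply, amp_apply,
    Finset.mul_sum, Finset.sum_mul]
  refine Finset.sum_congr rfl fun i _ => Finset.sum_congr rfl fun j _ => ?_
  rw [← mul_assoc, ← mul_assoc, ← mul_assoc, Algebra.commutes]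

/-- The weight `σ` absorbs the inner conjugation by `X`, leaving conjugation by `W` of the partial
trace. -/
theorem rightTrace_mem_mor {W : Matrix ι ι A} {X : Matrix κ κ A} {σ : Matrix κ κ ℂ}
    (hW : W ∈ unitary (Matrix ι ι A)) (hX : IsModular X σ) {T : Matrix (ι × κ) (ι × κ) ℂ}
    (hT : T ∈ Mor (UnitaryRep.tensorMat W X) (UnitaryRep.tensorMat W X)) :
    rightTrace σ T ∈ Mor W W := by
  rw [mem_mor_iff_conj hW]
  have h := (mem_mor_iff_conj (UnitaryRep.tensorMat_unitary hW hX.mem_unitary)).1 hT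
  have e (p q : ι) : amp A (rightTrace σ T) p q =
      (amp A σ * amp A (Matrix.of fun i j => T (p, i) (q, j))).trace := by
    rw [← amp_mul, trace_amp]
    rfl
  have e2 (p q : ι) : amp A (Matrix.of fun i j => T (p, i) (q, j)) =
      ∑ s, ∑ r, Matrix.of fun i j => W p r *
        (X * amp A (Matrix.of fun k l => T (r, k) (s, l)) * X.conjTranspose) i j *
          star (W q s) := by
    ext i j
    simp only [Matrix.sum_apply, Matrix.of_apply]
    rw [← tensorMat_conj_apply, h]
    rfl
  ext p q
  rw [e p q, e2]
  simp only [Matrix.mul_sum, Matrix.trace_sum, trace_amp_mul_of, hX.trace_amp_conj]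
  simp only [Matrix.mul_apply, Matrix.conjTranspose_apply, Finset.sum_mul]
  rfl

/-- Here `W` is the innermost factor, in the order `W⋆ (·) W`, for which the invariant weight is
`ρ⁻¹` and not `ρ`. -/
theorem leftTrace_mem_mor {W : Matrix ι ι A} {X : Matrix κ κ A} {ρ : Matrix ι ι ℂ}
    (hW : IsModular W ρ) (hX : X ∈ unitary (Matrix κ κ A)) {T : Matrix (ι × κ) (ι × κ) ℂ}
    (hT : T ∈ Mor (UnitaryRep.tensorMat W X) (UnitaryRep.tensorMat W X)) :
    leftTrace ρ⁻¹ T ∈ Mor X X := by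
  rw [mem_mor_iff_conj' hX]
  have h := (mem_mor_iff_conj' (UnitaryRep.tensorMat_unitary hW.mem_unitary hX)).1 hT
  have e (i j : κ) : amp A (leftTrace ρ⁻¹ T) i j =
      (amp A ρ⁻¹ * amp A (Matrix.of fun p q => T (p, i) (q, j))).trace := by
    rw [← amp_mul, trace_amp]
    rfl
  have e2 (i j : κ) : amp A (Matrix.of fun p q => T (p, i) (q, j)) =
      ∑ l, ∑ k, Matrix.of fun p q => star (X k i) *
        (W.conjTranspose * amp A (Matrix.of fun r s => T (r, k) (s, l)) * W) p q * X l j := by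
    ext p q
    simp only [Matrix.sum_apply, Matrix.of_apply]
    rw [← tensorMat_conj_apply', h]
    rfl
  ext i j
  rw [e i j, e2]
  simp only [Matrix.mul_sum, Matrix.trace_sum, trace_amp_mul_of, hW.trace_amp_conj']
  simp only [Matrix.mul_apply, Matrix.conjTranspose_apply, Finset.sum_mul]
  rfl

theorem IsModular.tensor {W : Matrix ι ι A} {X : Matrix κ κ A} {ρ : Matrix ι ι ℂ}
    {σ : Matrix κ κ ℂ} (hW : IsModular W ρ) (hX : IsModular X σ) :
    IsModular (UnitaryRep.tensorMat W X) (ρ ⊗ₖ σ) where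
  mem_unitary := UnitaryRep.tensorMat_unitary hW.mem_unitary hX.mem_unitary
  posDef := hW.posDef.kronecker hX.posDef
  left := by
    rw [left_iff]
    rintro ⟨k, k'⟩ ⟨l, l'⟩
    simp only [Fintype.sum_prod_type, Matrix.kroneckerMap_apply, UnitaryRep.tensorMat, star_mul]
    rw [map_mul, ← left_iff.1 hW.left, Finset.sum_mul]
    refine Finset.sum_congr rfl fun i _ => ?_
    rw [Finset.sum_comm, Finset.sum_mul]
    refine Finset.sum_congr rfl fun j _ => ?_
    rw [smul_mul_assoc, mul_assoc, ← Algebra.commutes, ← left_iff.1 hX.left, Finset.sum_mul,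
      Finset.mul_sum, Finset.smul_sum]
    refine Finset.sum_congr rfl fun i' _ => ?_
    rw [Finset.sum_mul, Finset.mul_sum, Finset.smul_sum]
    refine Finset.sum_congr rfl fun j' _ => ?_
    rw [mul_smul, smul_mul_assoc, mul_smul_comm]
    simp only [mul_assoc]
  right := by
    rw [Matrix.inv_kronecker, right_iff]
    rintro ⟨k, k'⟩ ⟨l, l'⟩
    simp only [Fintype.sum_prod_type, Matrix.kroneckerMap_apply, UnitaryRep.tensorMat, star_mul]
    -- In `X⋆ W⋆ W X` the outer factor is `X`, so the scalars are exchanged to expand `X` before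
    -- `W`, the opposite of the order in `left`.
    rw [map_mul, Algebra.commutes, ← right_iff.1 hX.right, Finset.sum_mul, Finset.sum_comm]
    refine Finset.sum_congr rfl fun i' _ => ?_
    rw [Finset.sum_mul]
    rw [Finset.sum_congr rfl fun i _ => Finset.sum_comm, Finset.sum_comm]
    refine Finset.sum_congr rfl fun j' _ => ?_
    rw [smul_mul_assoc, mul_assoc, ← Algebra.commutes, ← right_iff.1 hW.right, Finset.sum_mul,
      Finset.mul_sum, Finset.smul_sum]
    refine Finset.sum_congr rfl fun i _ => ?_
    rw [Finset.sum_mul, Finset.mul_sum, Finset.smul_sum]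
    refine Finset.sum_congr rfl fun j _ => ?_
    rw [mul_comm (ρ⁻¹ _ _), mul_smul, smul_mul_assoc, mul_smul_comm]
    simp only [mul_assoc]
  -- One leg is inverted at a time: from `ρ ⊗ σ` to `ρ⁻¹ ⊗ σ`, then to `ρ⁻¹ ⊗ σ⁻¹`. The intermediate
  -- weight makes the available partial traces, with `σ` on the right and `ρ⁻¹` on the left, exactly
  -- the ones needed.
  trace_eq T hT := by
    rw [Matrix.inv_kronecker, trace_mul_kronecker_eq_right,
      hW.trace_eq _ (rightTrace_mem_mor hW.mem_unitary hX hT), ← trace_mul_kronecker_eq_right,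
      trace_mul_kronecker_eq_left, hX.trace_eq _ (leftTrace_mem_mor hW hX.mem_unitary hT),
      ← trace_mul_kronecker_eq_left]

end PartialTrace

/-! ### The double contragredient and minimal projections -/

section Projections

variable {A : Type u} [CStarAlgebra A] {ι : Type} [Fintype ι] [DecidableEq ι]

theorem inverse_eq_conjTranspose {W : Matrix ι ι A} (hW : W ∈ unitary (Matrix ι ι A)) :
    Ring.inverse W = W.conjTranspose :=
  Ring.inverse_unit ⟨W, W.conjTranspose, unitary_mul_star hW, unitary_star_mul hW⟩

/-- For unitary `W` the contragredient is `W.map star`, so `Wᶜᶜ` is the transpose of its inverse and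
`ρ ∈ Mor(W, Wᶜᶜ)` identifies this with `ρWρ⁻¹`. -/
theorem isModular_of_mem_mor {W : Matrix ι ι A} (hW : W ∈ unitary (Matrix ι ι A))
    {ρ : Matrix ι ι ℂ} (hρ : ρ.PosDef) (h : ρ ∈ Mor W (contragredient (contragredient W)))
    (htr : ∀ T ∈ Mor W W, (T * ρ).trace = (T * ρ⁻¹).trace) : IsModular W ρ := by
  have hc : contragredient W = W.map star := by
    rw [contragredient, inverse_eq_conjTranspose hW]; rfl
  change contragredient (contragredient W) * amp A ρ = amp A ρ * W at h
  have e1 : amp A ρ * W * (W.conjTranspose * amp A ρ⁻¹) = 1 := by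
    rw [Matrix.mul_assoc, ← Matrix.mul_assoc W, unitary_mul_star hW, Matrix.one_mul, ← amp_mul,
      hρ.mul_inv_cancel, amp_one]
  rw [hc] at h
  -- `Ring.inverse` is `0` off the units. In that case `h` would give `ρW = 0`, although `ρW` is
  -- invertible; then the matrix ring is trivial and everything in it is a unit.
  have hu : IsUnit (W.map star) := by
    by_contra hu
    rw [contragredient, Ring.inverse_non_unit _ hu, Matrix.transpose_zero, Matrix.zero_mul] at h
    rw [← h, Matrix.zero_mul] at e1
    have : Subsingleton (Matrix ι ι A) := subsingleton_of_zero_eq_one e1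
    exact hu (isUnit_of_subsingleton _)
  set Y := Ring.inverse (W.map star) with hY
  have hY1 : Y * W.map star = 1 := Ring.inverse_mul_cancel _ hu
  have hY2 : W.map star * Y = 1 := Ring.mul_inverse_cancel _ hu
  have h' : amp A ρ * W = Y.transpose * amp A ρ := h.symm
  refine ⟨hW, hρ, ?_, ?_, htr⟩
  · rw [h', transpose_mul_amp, Matrix.transpose_transpose, Matrix.mul_assoc, hY1, Matrix.mul_one]
  · have h2 : W * amp A ρ⁻¹ = amp A ρ⁻¹ * Y.transpose := by
      calc W * amp A ρ⁻¹ = amp A ρ⁻¹ * (amp A ρ * W) * amp A ρ⁻¹ := by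
            rw [← Matrix.mul_assoc, ← amp_mul, hρ.inv_mul_cancel, amp_one, Matrix.one_mul]
        _ = amp A ρ⁻¹ * Y.transpose := by
            rw [h', Matrix.mul_assoc, Matrix.mul_assoc, ← amp_mul, hρ.mul_inv_cancel, amp_one,
              Matrix.mul_one]
    rw [h2, transpose_amp_mul, Matrix.transpose_transpose, ← Matrix.mul_assoc, hY2, Matrix.one_mul]

theorem rank_lt_of_mul_eq_of_ne {ι : Type} [Fintype ι] {e f : Matrix ι ι ℂ} (hf : IsStarProjection f)
    (he : IsStarProjection e) (hfe : f * e = f) (hne : f ≠ e) : f.rank < e.rank := by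
  have hef : e * f = f := by
    have := congrArg star hfe
    rwa [star_mul, hf.isSelfAdjoint.star_eq, he.isSelfAdjoint.star_eq] at this
  refine Submodule.finrank_lt_finrank_of_lt (lt_of_le_of_ne ?_ fun h => hne ?_)
  · rintro _ ⟨x, rfl⟩
    refine ⟨f.mulVec x, ?_⟩
    simp only [Matrix.mulVecLin_apply, Matrix.mulVec_mulVec, hef]
  · rw [← hfe]
    refine Matrix.mulVec_injective (funext fun x => ?_)
    obtain ⟨y, hy⟩ : e.mulVecLin x ∈ LinearMap.range f.mulVecLin := h ▸ ⟨x, rfl⟩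
    simp only [Matrix.mulVecLin_apply] at hy
    rw [← Matrix.mulVec_mulVec, ← hy, Matrix.mulVec_mulVec, hf.isIdempotentElem.eq]

/-- A minimal nonzero projection of `End(W)`. -/
structure IsMinimalProjection (W : Matrix ι ι A) (p : Matrix ι ι ℂ) : Prop where
  isStarProjection : IsStarProjection p
  mem_mor : p ∈ Mor W W
  ne_zero : p ≠ 0
  eq_or_eq : ∀ f, IsStarProjection f → f ∈ Mor W W → f * p = f → f = 0 ∨ f = p

/-- Induction on the rank: a projection that is not minimal splits as `f + (e - f)` into orthogonal
intertwining projections of smaller rank. -/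
theorem exists_minimal_projections {ι : Type} [Fintype ι] [DecidableEq ι] (W : Matrix ι ι A) (e : Matrix ι ι ℂ)
    (he : IsStarProjection e) (heW : e ∈ Mor W W) :
    ∃ (κ : Type) (_ : Fintype κ) (p : κ → Matrix ι ι ℂ), (∀ k, IsMinimalProjection W (p k)) ∧
      (∀ k, p k * e = p k) ∧ (∀ k l, k ≠ l → p k * p l = 0) ∧ ∑ k, p k = e := by
  induction hr : e.rank using Nat.strong_induction_on generalizing e with
  | _ r ih =>
  by_cases h0 : e = 0
  · exact ⟨Empty, inferInstance, fun k => k.elim, fun k => k.elim, fun k => k.elim,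
      fun k => k.elim, by simp [h0]⟩
  by_cases hmin : ∀ f, IsStarProjection f → f ∈ Mor W W → f * e = f → f = 0 ∨ f = e
  · exact ⟨Unit, inferInstance, fun _ => e, fun _ => ⟨he, heW, h0, hmin⟩,
      fun _ => he.isIdempotentElem.eq, fun k l hkl => (hkl rfl).elim, by simp⟩
  push Not at hmin
  obtain ⟨f, hf, hfW, hfe, hf0, hfne⟩ := hmin
  have hef : e * f = f := by
    have := congrArg star hfe
    rwa [star_mul, hf.isSelfAdjoint.star_eq, he.isSelfAdjoint.star_eq] at this
  have hg : IsStarProjection (e - f) := hf.sub_of_mul_eq_left he hfe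
  have hge : (e - f) * e = e - f := by rw [Matrix.sub_mul, he.isIdempotentElem.eq, hfe]
  have hgf : (e - f) * f = 0 := by rw [Matrix.sub_mul, hf.isIdempotentElem.eq, hef, sub_self]
  have hfg : f * (e - f) = 0 := by rw [Matrix.mul_sub, hf.isIdempotentElem.eq, hfe, sub_self]
  obtain ⟨κ, _, p, hp, hpf, hpp, hps⟩ :=
    ih _ (hr ▸ rank_lt_of_mul_eq_of_ne hf he hfe hfne) f hf hfW rfl
  obtain ⟨μ, _, q, hq, hqg, hqq, hqs⟩ := ih _
    (hr ▸ rank_lt_of_mul_eq_of_ne hg he hge (by simpa using hf0)) (e - f) hg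
    (sub_mem_mor heW hfW) rfl
  have left {x y : Matrix ι ι ℂ} (hx : IsStarProjection x) (hy : IsStarProjection y)
      (h : x * y = x) : y * x = x := by
    have := congrArg star h
    rwa [star_mul, hx.isSelfAdjoint.star_eq, hy.isSelfAdjoint.star_eq] at this
  refine ⟨κ ⊕ μ, inferInstance, Sum.elim p q, ?_, ?_, ?_, ?_⟩
  · rintro (k | k)
    exacts [hp k, hq k]
  · rintro (k | k)
    · change p k * e = p k
      rw [← hpf k, Matrix.mul_assoc, hfe]
    · change q k * e = q k
      rw [← hqg k, Matrix.mul_assoc, hge]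
  · rintro (k | k) (l | l) hkl
    · exact hpp k l fun h => hkl (h ▸ rfl)
    · change p k * q l = 0
      rw [← hpf k, ← left (hq l).isStarProjection hg (hqg l), Matrix.mul_assoc,
        ← Matrix.mul_assoc f, hfg, Matrix.zero_mul, Matrix.mul_zero]
    · change q k * p l = 0
      rw [← hqg k, ← left (hp l).isStarProjection hf (hpf l), Matrix.mul_assoc,
        ← Matrix.mul_assoc (e - f), hgf, Matrix.zero_mul, Matrix.mul_zero]
    · exact hqq k l fun h => hkl (h ▸ rfl)
  · rw [Fintype.sum_sum_type]
    simp [hps, hqs]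

end Projections

/-! ### Sums and scalars in elementary tensors -/

section TensorSums

variable {A B : Type u} [CStarAlgebra A] [CStarAlgebra B]

theorem MinTensor.tmul_sum {μ : Type*} (s : Finset μ) (a : A) (b : μ → B) :
    tmul a (∑ i ∈ s, b i) = ∑ i ∈ s, tmul a (b i) := by
  simp only [tmul, TensorProduct.tmul_sum, map_sum]

theorem MinTensor.sum_tmul {μ : Type*} (s : Finset μ) (a : μ → A) (b : B) :
    tmul (∑ i ∈ s, a i) b = ∑ i ∈ s, tmul (a i) b := by
  simp only [tmul, TensorProduct.sum_tmul, map_sum]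

theorem MinTensor.tmul_algebraMap_mul (c : ℂ) (a : A) (b : B) :
    tmul a (algebraMap ℂ B c * b) = algebraMap ℂ _ c * tmul a b := by
  simp only [tmul, ← Algebra.smul_def, TensorProduct.tmul_smul, map_smul]

theorem MinTensor.algebraMap_mul_tmul (c : ℂ) (a : A) (b : B) :
    tmul (algebraMap ℂ A c * a) b = algebraMap ℂ _ c * tmul a b := by
  simp only [tmul, ← Algebra.smul_def, ← TensorProduct.smul_tmul', map_smul]

end TensorSums

/-! ### Decomposition into irreducibles and the trace estimate -/

namespace UnitaryRep

variable {G : CompactQuantumGroup.{u}}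

theorem IsRho.isModular {U : UnitaryRep G} {ρ : Matrix U.idx U.idx ℂ} (h : U.IsRho ρ) :
    IsModular U.mat ρ :=
  isModular_of_mem_mor U.mem_unitary h.posDef h.mem_mor h.trace_eq

/-- The subrepresentation on the range of an isometry `V` with `V V⋆ ∈ End(W)`. -/
noncomputable def sub (W : UnitaryRep G) {κ : Type} [Fintype κ] [DecidableEq κ] (V : Matrix W.idx κ ℂ)
    (hV : V.conjTranspose * V = 1) (hW : V * V.conjTranspose ∈ Mor W.mat W.mat) :
    UnitaryRep G where
  idx := κ
  mat := amp G.A V.conjTranspose * W.mat * amp G.A V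
  mem_unitary := by
    have h1 := mul_eq_of_mem_mor hW
    have h2 : (amp G.A V.conjTranspose * W.mat * amp G.A V).conjTranspose =
        amp G.A V.conjTranspose * W.mat.conjTranspose * amp G.A V := by
      rw [Matrix.conjTranspose_mul, Matrix.conjTranspose_mul, ← amp_conjTranspose,
        ← amp_conjTranspose, Matrix.conjTranspose_conjTranspose, Matrix.mul_assoc]
    have h3 : V.conjTranspose * (V * V.conjTranspose) * V = 1 := by
      rw [← Matrix.mul_assoc, hV, Matrix.one_mul, hV]
    rw [Unitary.mem_iff, Matrix.star_eq_conjTranspose, h2]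
    constructor
    · calc _ = amp G.A V.conjTranspose * W.mat.conjTranspose *
            (amp G.A (V * V.conjTranspose) * W.mat) * amp G.A V := by
            rw [amp_mul]; simp only [Matrix.mul_assoc]
        _ = amp G.A V.conjTranspose * (W.mat.conjTranspose * W.mat) *
            amp G.A (V * V.conjTranspose) * amp G.A V := by
            rw [← h1]; simp only [Matrix.mul_assoc]
        _ = 1 := by
            rw [unitary_star_mul W.mem_unitary, Matrix.mul_one, ← amp_mul, ← amp_mul, h3, amp_one]
    · calc _ = amp G.A V.conjTranspose *
            (W.mat * amp G.A (V * V.conjTranspose)) * W.mat.conjTranspose * amp G.A V := by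
            rw [amp_mul]; simp only [Matrix.mul_assoc]
        _ = amp G.A V.conjTranspose * amp G.A (V * V.conjTranspose) *
            (W.mat * W.mat.conjTranspose) * amp G.A V := by
            rw [h1]; simp only [Matrix.mul_assoc]
        _ = 1 := by
            rw [unitary_mul_star W.mem_unitary, Matrix.mul_one, ← amp_mul, ← amp_mul, h3, amp_one]
  comul i j := by
    have h1 : amp G.A V.conjTranspose * W.mat * amp G.A V * amp G.A V.conjTranspose =
        amp G.A V.conjTranspose * W.mat := by
      rw [Matrix.mul_assoc, ← amp_mul, Matrix.mul_assoc, mul_eq_of_mem_mor hW, ← Matrix.mul_assoc,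
        ← amp_mul, ← Matrix.mul_assoc, hV, Matrix.one_mul]
    set α := amp G.A V.conjTranspose * W.mat * amp G.A V with hα
    have hα' : ∀ k, α k j = ∑ c, algebraMap ℂ G.A (V.conjTranspose k c) *
        (W.mat * amp G.A V) c j := fun k => by
      rw [hα, Matrix.mul_assoc, Matrix.mul_apply]; rfl
    -- The sum over the small index set inserts `VV⋆` between the two tensor legs, and `V⋆W` absorbs
    -- it by `h1`.
    have e1 : ∑ k, MinTensor.tmul (α i k) (α k j) =
        ∑ c, MinTensor.tmul ((amp G.A V.conjTranspose * W.mat) i c)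
          ((W.mat * amp G.A V) c j) := by
      simp only [hα', MinTensor.tmul_sum]
      rw [Finset.sum_comm]
      refine Finset.sum_congr rfl fun c _ => ?_
      rw [← h1, Matrix.mul_apply (M := α), MinTensor.sum_tmul]
      refine Finset.sum_congr rfl fun k _ => ?_
      rw [MinTensor.tmul_algebraMap_mul, amp_apply, ← Algebra.commutes,
        MinTensor.algebraMap_mul_tmul]
    rw [e1, hα]
    have e2 : (amp G.A V.conjTranspose * W.mat * amp G.A V) i j =
        ∑ b, ∑ a, algebraMap ℂ G.A (V.conjTranspose i a) * W.mat a b * algebraMap ℂ G.A (V b j) := by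
      simp only [Matrix.mul_apply, Finset.sum_mul]; rfl
    have hΔ : ∀ c : ℂ, G.Δ (algebraMap ℂ G.A c) = algebraMap ℂ _ c := fun c =>
      G.Δ.toAlgHom.commutes c
    rw [e2]
    simp only [map_sum, map_mul, hΔ, W.comul, Finset.mul_sum, Finset.sum_mul]
    simp only [Matrix.mul_apply, amp_apply, MinTensor.sum_tmul, MinTensor.tmul_sum]
    simp only [← Algebra.commutes, MinTensor.tmul_algebraMap_mul, MinTensor.algebraMap_mul_tmul]
    rw [Finset.sum_congr rfl fun b _ => Finset.sum_comm, Finset.sum_comm]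

/-- An invariant projection `e` of the subrepresentation gives an invariant projection `VeV⋆` of
`W`. Complete reducibility puts it in `End(W)`, where minimality of `VV⋆` applies. -/
theorem sub_irreducible {W : UnitaryRep G} {ρ : Matrix W.idx W.idx ℂ} (hρ : IsModular W.mat ρ)
    {κ : Type} [Fintype κ] [DecidableEq κ] {V : Matrix W.idx κ ℂ}
    (hV : V.conjTranspose * V = 1) (hp : IsMinimalProjection W.mat (V * V.conjTranspose)) :
    (W.sub V hV hp.mem_mor).Irreducible := by
  refine ⟨?_, fun e he hinv => ?_⟩
  · change Nonempty κ
    by_contra h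
    rw [not_nonempty_iff] at h
    exact hp.ne_zero (by ext i j; simp [Matrix.mul_apply])
  change Matrix κ κ ℂ at e
  change amp G.A V.conjTranspose * W.mat * amp G.A V * amp G.A e =
    amp G.A e * (amp G.A V.conjTranspose * W.mat * amp G.A V) * amp G.A e at hinv
  set f := V * e * V.conjTranspose with hf
  have hfp : f * (V * V.conjTranspose) = f := by
    rw [hf, Matrix.mul_assoc, ← Matrix.mul_assoc _ V, hV, Matrix.one_mul]
  have hef : V.conjTranspose * f * V = e := by
    rw [hf, ← Matrix.mul_assoc, ← Matrix.mul_assoc, hV, Matrix.one_mul, Matrix.mul_assoc, hV,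
      Matrix.mul_one]
  have hfproj : IsStarProjection f := by
    constructor
    · change f * f = f
      calc f * f = V * e * (V.conjTranspose * V) * e * V.conjTranspose := by
            rw [hf]; simp only [Matrix.mul_assoc]
        _ = V * (e * e) * V.conjTranspose := by rw [hV, Matrix.mul_one, Matrix.mul_assoc V]
        _ = f := congrArg (V * · * V.conjTranspose) he.isIdempotentElem.eq
    · change f.conjTranspose = f
      have : e.conjTranspose = e := he.isSelfAdjoint
      rw [hf, Matrix.conjTranspose_mul, Matrix.conjTranspose_mul, this,
        Matrix.conjTranspose_conjTranspose, Matrix.mul_assoc]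
  have hWV : W.mat * amp G.A V = amp G.A V * (amp G.A V.conjTranspose * W.mat * amp G.A V) := by
    calc W.mat * amp G.A V = W.mat * amp G.A (V * V.conjTranspose) * amp G.A V := by
          rw [Matrix.mul_assoc, ← amp_mul, Matrix.mul_assoc, hV, Matrix.mul_one]
      _ = _ := by rw [mul_eq_of_mem_mor hp.mem_mor, amp_mul]; simp only [Matrix.mul_assoc]
  have hfW : W.mat * amp G.A f = amp G.A f * W.mat * amp G.A f := by
    have e1 : W.mat * amp G.A f = amp G.A V * (amp G.A V.conjTranspose * W.mat * amp G.A V) *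
        amp G.A e * amp G.A V.conjTranspose := by
      rw [hf, amp_mul, amp_mul, ← Matrix.mul_assoc, ← Matrix.mul_assoc, ← hWV]
    calc W.mat * amp G.A f = amp G.A V * (amp G.A V.conjTranspose * W.mat * amp G.A V *
        amp G.A e) * amp G.A V.conjTranspose := by rw [e1]; simp only [Matrix.mul_assoc]
      _ = _ := by rw [hinv, hf, amp_mul, amp_mul]; simp only [Matrix.mul_assoc]
  rcases hp.eq_or_eq f hfproj (hρ.mem_mor_of_invariant hfproj hfW) hfp with h | h
  · left
    rw [← hef, h, Matrix.mul_zero, Matrix.zero_mul]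
    rfl
  · right
    rw [← hef, h, ← Matrix.mul_assoc, hV, Matrix.one_mul, hV]
    rfl

/-- Compare `Tr(ST)` with `Tr(TS)`. -/
theorem card_eq_of_equivalent {U V : UnitaryRep G} (h : U.Equivalent V) : U.dim = V.dim := by
  obtain ⟨S, -, T, -, h1, h2⟩ := h
  have := Matrix.trace_mul_comm S T
  rw [h1, h2, Matrix.trace_one, Matrix.trace_one] at this
  exact_mod_cast this.symm

theorem le_dim_of_mem_irrDims {V : UnitaryRep G} {d : ℕ} (h : d ∈ V.irrDims) : d ≤ V.dim := by
  obtain ⟨N, α, -, hα, k, rfl⟩ := h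
  rw [card_eq_of_equivalent hα]
  change Fintype.card (α k).idx ≤ Fintype.card (Σ k, (α k).idx)
  exact Fintype.card_le_of_injective (fun i => (⟨k, i⟩ : Σ k, (α k).idx))
    fun i j h => eq_of_heq (Sigma.mk.inj h).2

/-- `sSup` of an unbounded set of naturals is `0`, so the bound by the dimension of the tensor power
is essential. -/
theorem le_P_of_mem_irrDims (U : UnitaryRep G) {n d : ℕ} (h : d ∈ (U.tpow n).irrDims) :
    d ≤ U.P n :=
  le_csSup ⟨_, fun _ hd => le_dim_of_mem_irrDims hd⟩ h

theorem equivalent_directSum {W : UnitaryRep G} {N : ℕ} {r : Fin N → ℕ}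
    (V : ∀ k, Matrix W.idx (Fin (r k)) ℂ) (hV : ∀ k, (V k).conjTranspose * V k = 1)
    (hW : ∀ k, V k * (V k).conjTranspose ∈ Mor W.mat W.mat)
    (horth : ∀ k l, k ≠ l → (V k).conjTranspose * V l = 0)
    (hsum : ∑ k, V k * (V k).conjTranspose = 1) :
    W.Equivalent (directSum fun k => W.sub (V k) (hV k) (hW k)) := by
  -- The `V k` placed side by side form `T`, and their adjoints stacked form `S`.
  let S : Matrix (Σ k, Fin (r k)) W.idx ℂ := fun x a => (V x.1).conjTranspose x.2 a
  let T : Matrix W.idx (Σ k, Fin (r k)) ℂ := fun a x => V x.1 a x.2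
  have hcomm1 : ∀ k, (amp G.A (V k).conjTranspose * W.mat * amp G.A (V k)) *
      amp G.A (V k).conjTranspose = amp G.A (V k).conjTranspose * W.mat := fun k => by
    rw [Matrix.mul_assoc, ← amp_mul, Matrix.mul_assoc, mul_eq_of_mem_mor (hW k),
      ← Matrix.mul_assoc, ← amp_mul, ← Matrix.mul_assoc, hV, Matrix.one_mul]
  have hcomm2 : ∀ k, amp G.A (V k) * (amp G.A (V k).conjTranspose * W.mat * amp G.A (V k)) =
      W.mat * amp G.A (V k) := fun k => by
    rw [← Matrix.mul_assoc, ← Matrix.mul_assoc, ← amp_mul, ← mul_eq_of_mem_mor (hW k),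
      Matrix.mul_assoc, ← amp_mul, Matrix.mul_assoc, hV, Matrix.mul_one]
  refine ⟨S, ?_, T, ?_, ?_, ?_⟩
  · change Matrix.blockDiagonal' (fun k => amp G.A (V k).conjTranspose * W.mat * amp G.A (V k)) *
      amp G.A S = amp G.A S * W.mat
    ext ⟨k, i⟩ a
    rw [Matrix.mul_apply, Fintype.sum_sigma, Finset.sum_eq_single k]
    · simp only [Matrix.blockDiagonal'_apply_eq]
      exact congrFun₂ (hcomm1 k) i a
    · intro l _ hl
      refine Finset.sum_eq_zero fun j _ => ?_
      rw [Matrix.blockDiagonal'_apply_ne _ _ _ hl.symm, zero_mul]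
    · simp
  · change W.mat * amp G.A T = amp G.A T *
      Matrix.blockDiagonal' (fun k => amp G.A (V k).conjTranspose * W.mat * amp G.A (V k))
    ext a ⟨k, i⟩
    rw [Matrix.mul_apply (M := amp G.A T), Fintype.sum_sigma, Finset.sum_eq_single k]
    · simp only [Matrix.blockDiagonal'_apply_eq]
      exact (congrFun₂ (hcomm2 k) a i).symm
    · intro l _ hl
      refine Finset.sum_eq_zero fun j _ => ?_
      rw [Matrix.blockDiagonal'_apply_ne _ _ _ hl, mul_zero]
    · simp
  · change T * S = 1
    rw [← hsum]
    ext a b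
    rw [Matrix.mul_apply, Fintype.sum_sigma, Matrix.sum_apply]
    rfl
  · change S * T = (1 : Matrix (Σ k, Fin (r k)) (Σ k, Fin (r k)) ℂ)
    ext ⟨k, i⟩ ⟨l, j⟩
    change ((V k).conjTranspose * V l) i j = _
    by_cases hkl : k = l
    · subst hkl
      rw [hV, Matrix.one_apply, Matrix.one_apply]
      simp
    · rw [horth k l hkl, Matrix.one_apply_ne (fun h => hkl (congrArg Sigma.fst h))]
      rfl

/-- Decomposition into irreducible representations, by isometric intertwiners. -/
theorem exists_decomposition {W : UnitaryRep G} {ρ : Matrix W.idx W.idx ℂ}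
    (hρ : IsModular W.mat ρ) :
    ∃ (N : ℕ) (r : Fin N → ℕ) (V : ∀ k, Matrix W.idx (Fin (r k)) ℂ),
      (∀ k, (V k).conjTranspose * V k = 1) ∧
      (∀ k, V k * (V k).conjTranspose ∈ Mor W.mat W.mat) ∧
      ∑ k, V k * (V k).conjTranspose = 1 ∧ ∀ k, r k ∈ W.irrDims := by
  obtain ⟨κ, _, p, hp, -, horth, hsum⟩ :=
    exists_minimal_projections W.mat 1 (IsStarProjection.one _) one_mem_mor
  let e := (Fintype.equivFin κ).symm
  choose r V hV hVp using fun k => (hp (e k)).isStarProjection.exists_isometry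
  have hmin : ∀ k, IsMinimalProjection W.mat (V k * (V k).conjTranspose) := fun k => by
    rw [hVp]; exact hp (e k)
  have hs : ∑ k, V k * (V k).conjTranspose = 1 := by
    simp only [hVp]
    rw [e.sum_comp p, hsum]
  refine ⟨_, r, V, hV, fun k => (hmin k).mem_mor, hs, fun k =>
    ⟨_, _, fun k => sub_irreducible hρ (hV k) (hmin k),
      equivalent_directSum V hV (fun k => (hmin k).mem_mor) (fun k l hkl => ?_) hs, k, ?_⟩⟩
  · have h := horth (e k) (e l) (e.injective.ne hkl)
    rw [← hVp, ← hVp] at h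
    calc (V k).conjTranspose * V l = (V k).conjTranspose * V k * (V k).conjTranspose *
          (V l * ((V l).conjTranspose * V l)) := by
          rw [hV, hV, Matrix.one_mul, Matrix.mul_one]
      _ = (V k).conjTranspose * (V k * (V k).conjTranspose * (V l * (V l).conjTranspose)) *
          V l := by simp only [Matrix.mul_assoc]
      _ = 0 := by rw [h, Matrix.mul_zero, Matrix.zero_mul]
  · exact Fintype.card_fin _

/-- Cut `ρ` down to the irreducible components, apply `Matrix.PosDef.re_trace_pow_le` on each, and
sum. This works because `ρ` commutes with the projections onto the components. -/
theorem re_trace_pow_le_of_irrDims_le {W : UnitaryRep G} {ρ : Matrix W.idx W.idx ℂ}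
    (hρ : IsModular W.mat ρ) {D : ℕ} (hD : ∀ d ∈ W.irrDims, d ≤ D) {s : ℕ} (hs : s ≠ 0) :
    (ρ ^ s).trace.re ≤ (D : ℝ) ^ s * (ρ⁻¹ ^ s).trace.re ∧
      (ρ⁻¹ ^ s).trace.re ≤ (D : ℝ) ^ s * (ρ ^ s).trace.re := by
  obtain ⟨N, r, V, hV, hVW, hsum, hr⟩ := exists_decomposition hρ
  have htr : ∀ M : Matrix W.idx W.idx ℂ,
      M.trace.re = ∑ k, ((V k).conjTranspose * M * V k).trace.re := fun M => by
    have : M = ∑ k, M * (V k * (V k).conjTranspose) := by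
      rw [← Matrix.mul_sum, hsum, Matrix.mul_one]
    conv_lhs => rw [this, Matrix.trace_sum, Complex.re_sum]
    refine Finset.sum_congr rfl fun k _ => ?_
    rw [← Matrix.mul_assoc, Matrix.trace_mul_comm, Matrix.mul_assoc]
  have c1 := hρ.posDef.inv_mul_cancel
  have c2 := hρ.posDef.mul_inv_cancel
  have hcomm : ∀ k, ρ * (V k * (V k).conjTranspose) = V k * (V k).conjTranspose * ρ := fun k =>
    hρ.mul_comm_of_mem_mor (hVW k)
  have hcomm' : ∀ k, ρ⁻¹ * (V k * (V k).conjTranspose) = V k * (V k).conjTranspose * ρ⁻¹ :=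
    fun k => by
      calc _ = ρ⁻¹ * (V k * (V k).conjTranspose * ρ) * ρ⁻¹ := by
            rw [Matrix.mul_assoc, Matrix.mul_assoc _ ρ, c2, Matrix.mul_one]
        _ = _ := by rw [← hcomm, ← Matrix.mul_assoc, c1, Matrix.one_mul]
  -- Compression by `V k` is multiplicative against operators commuting with its range projection;
  -- hence it respects powers and inverses of `ρ`.
  have hcut : ∀ k (M R : Matrix W.idx W.idx ℂ),
      R * (V k * (V k).conjTranspose) = V k * (V k).conjTranspose * R →
      (V k).conjTranspose * M * V k * ((V k).conjTranspose * R * V k) =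
        (V k).conjTranspose * (M * R) * V k := fun k M R h => by
    calc _ = (V k).conjTranspose * M * (V k * (V k).conjTranspose * R) * V k := by
          simp only [Matrix.mul_assoc]
      _ = (V k).conjTranspose * (M * R) * (V k * ((V k).conjTranspose * V k)) := by
          rw [← h]; simp only [Matrix.mul_assoc]
      _ = _ := by rw [hV, Matrix.mul_one]
  have hpow : ∀ k (R : Matrix W.idx W.idx ℂ),
      R * (V k * (V k).conjTranspose) = V k * (V k).conjTranspose * R →
      ∀ t : ℕ, ((V k).conjTranspose * R * V k) ^ t = (V k).conjTranspose * R ^ t * V k :=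
    fun k R h t => by
      induction t with
      | zero => rw [pow_zero, pow_zero, Matrix.mul_one, hV]
      | succ t ih => rw [pow_succ, ih, hcut _ _ _ h, ← pow_succ]
  have hpos : ∀ k, ((V k).conjTranspose * ρ * V k).PosDef := fun k =>
    hρ.posDef.conjTranspose_mul_mul_same fun x y hxy => by
      have := congrArg (V k).conjTranspose.mulVec hxy
      simpa only [Matrix.mulVec_mulVec, hV, Matrix.one_mulVec] using this
  have hinv : ∀ k, ((V k).conjTranspose * ρ * V k)⁻¹ = (V k).conjTranspose * ρ⁻¹ * V k := fun k =>
    Matrix.inv_eq_left_inv (by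
      rw [hcut _ _ _ (hcomm k), c1, Matrix.mul_one, hV])
  have hinv' : ∀ k, ((V k).conjTranspose * ρ⁻¹ * V k)⁻¹ = (V k).conjTranspose * ρ * V k := fun k =>
    Matrix.inv_eq_left_inv (by
      rw [hcut _ _ _ (hcomm' k), c2, Matrix.mul_one, hV])
  -- The trace condition for the projection `T = V k (V k)⋆`, which lies in `End(W)`.
  have htrace : ∀ k, ((V k).conjTranspose * ρ * V k).trace =
      ((V k).conjTranspose * ρ⁻¹ * V k).trace := fun k => by
    rw [Matrix.mul_assoc, Matrix.trace_mul_comm, Matrix.mul_assoc, hcomm, hρ.trace_eq _ (hVW k),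
      ← hcomm', ← Matrix.mul_assoc, Matrix.trace_mul_comm, ← Matrix.mul_assoc]
  have hrD : ∀ k, (Fintype.card (Fin (r k)) : ℝ) ^ s ≤ (D : ℝ) ^ s := fun k => by
    rw [Fintype.card_fin]
    exact pow_le_pow_left₀ (Nat.cast_nonneg _) (Nat.cast_le.2 (hD _ (hr k))) _
  rw [htr (ρ ^ s), htr (ρ⁻¹ ^ s), Finset.mul_sum, Finset.mul_sum]
  refine ⟨Finset.sum_le_sum fun k _ => ?_, Finset.sum_le_sum fun k _ => ?_⟩
  · have h := (hpos k).re_trace_pow_le (by rw [hinv, htrace]) hs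
    have h0 : 0 ≤ (((V k).conjTranspose * ρ * V k)⁻¹ ^ s).trace.re :=
      (hpos k).inv.re_trace_pow_nonneg s
    rw [hinv] at h h0
    rw [hpow k _ (hcomm k), hpow k _ (hcomm' k)] at h
    rw [hpow k _ (hcomm' k)] at h0
    exact h.trans (mul_le_mul_of_nonneg_right (hrD k) h0)
  · have h := ((hpos k).inv).re_trace_pow_le (by rw [hinv, hinv', htrace]) hs
    have h0 := (hpos k).re_trace_pow_nonneg s
    rw [hinv, hinv', hpow k _ (hcomm k), hpow k _ (hcomm' k)] at h
    rw [hpow k _ (hcomm k)] at h0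
    exact h.trans (mul_le_mul_of_nonneg_right (hrD k) h0)

theorem kronecker_pow {ι κ : Type} [Fintype ι] [DecidableEq ι] [Fintype κ] [DecidableEq κ]
    (R : Matrix ι ι ℂ) (S : Matrix κ κ ℂ) (s : ℕ) : (R ⊗ₖ S) ^ s = (R ^ s) ⊗ₖ (S ^ s) := by
  induction s with
  | zero => rw [pow_zero, pow_zero, pow_zero, Matrix.one_kronecker_one]
  | succ s ih => rw [pow_succ, pow_succ, pow_succ, ih, Matrix.mul_kronecker_mul]

/-- The operator is `ρ^{⊗n}`, starting from `1` on the trivial representation; traces are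
multiplicative on Kronecker products. -/
theorem exists_isModular_tpow {U : UnitaryRep G} {ρ : Matrix U.idx U.idx ℂ}
    (hρ : IsModular U.mat ρ) (n : ℕ) :
    ∃ R : Matrix (U.tpow n).idx (U.tpow n).idx ℂ, IsModular (U.tpow n).mat R ∧
      ∀ s : ℕ, (R ^ s).trace = (ρ ^ s).trace ^ n ∧ (R⁻¹ ^ s).trace = (ρ⁻¹ ^ s).trace ^ n := by
  induction n with
  | zero =>
    change ∃ R : Matrix Unit Unit ℂ, IsModular (1 : Matrix Unit Unit G.A) R ∧
      ∀ s : ℕ, (R ^ s).trace = (ρ ^ s).trace ^ 0 ∧ (R⁻¹ ^ s).trace = (ρ⁻¹ ^ s).trace ^ 0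
    refine ⟨1, ⟨one_mem _, Matrix.PosDef.one, ?_, ?_, fun T _ => by rw [inv_one]⟩, fun s => ?_⟩
    · rw [left_iff]
      simp
    · rw [inv_one, right_iff]
      simp
    · simp
  | succ n ih =>
    obtain ⟨R, hR, htr⟩ := ih
    change ∃ S : Matrix ((U.tpow n).idx × U.idx) ((U.tpow n).idx × U.idx) ℂ,
      IsModular (tensorMat (U.tpow n).mat U.mat) S ∧ ∀ s : ℕ,
        (S ^ s).trace = (ρ ^ s).trace ^ (n + 1) ∧ (S⁻¹ ^ s).trace = (ρ⁻¹ ^ s).trace ^ (n + 1)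
    refine ⟨R ⊗ₖ ρ, hR.tensor hρ, fun s => ?_⟩
    rw [Matrix.inv_kronecker, kronecker_pow, kronecker_pow, Matrix.trace_kronecker,
      Matrix.trace_kronecker, (htr s).1, (htr s).2, pow_succ, pow_succ]
    exact ⟨rfl, rfl⟩

end UnitaryRep

/-! ### Growth comparison and conclusion -/

/-- Subexponential factors do not affect a comparison of exponential growth rates. -/
theorem le_of_forall_pow_le_mul {p : ℕ → ℝ}
    (hp : ∀ c : ℝ, 1 < c → Filter.Tendsto (fun n => p n / c ^ n) Filter.atTop (nhds 0))
    (hp0 : ∀ n, 0 ≤ p n) {a b : ℝ} (hb : 0 < b) {s : ℕ} (hs : s ≠ 0)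
    (h : ∀ n, a ^ n ≤ p n ^ s * b ^ n) : a ≤ b := by
  by_contra! hab
  have h1 : 1 < a / b := (one_lt_div hb).2 hab
  -- If `a > b`, this `c > 1` satisfies `c^s = a / b`, so `p n < c^n` at a single `n` already
  -- contradicts `h n`.
  set c := (a / b) ^ ((s : ℝ)⁻¹) with hc
  have hc1 : 1 < c := Real.one_lt_rpow h1 (by positivity)
  have hcs : c ^ s = a / b := Real.rpow_inv_natCast_pow (by linarith) hs
  obtain ⟨n, hn⟩ := ((hp c hc1).eventually_lt_const one_pos).exists
  have hcn : 0 < c ^ n := by positivity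
  rw [div_lt_one hcn] at hn
  have h2 : p n ^ s < (c ^ n) ^ s := pow_lt_pow_left₀ hn (hp0 n) hs
  have h3 := h n
  rw [pow_right_comm, hcs, div_pow, lt_div_iff₀ (by positivity)] at h2
  exact absurd h3 (not_le.2 h2)

end CQG

theorem theorem3p2 (G : CQG.CompactQuantumGroup) (U : CQG.UnitaryRep G)
    (hP : ∀ c : ℝ, 1 < c →
      Filter.Tendsto (fun n : ℕ => (U.P n : ℝ) / c ^ n) Filter.atTop (nhds 0))
    (ρ : Matrix U.idx U.idx ℂ) (hρ : U.IsRho ρ) :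
    Matrix.IsHermitian.eigenvalues₀ (A := ρ) hρ.posDef.isHermitian =
      Matrix.IsHermitian.eigenvalues₀ (A := ρ⁻¹) hρ.posDef.inv.isHermitian := by
  refine Matrix.IsHermitian.eigenvalues₀_eq_of_trace_pow_eq _ _ fun s => ?_
  -- The growth comparison needs strictly positive traces, which fails only on the zero space.
  rcases isEmpty_or_nonempty U.idx with hU | hU
  · simp [Matrix.trace]
  rcases eq_or_ne s 0 with rfl | hs
  · simp
  have key (n : ℕ) : (ρ ^ s).trace.re ^ n ≤ (U.P n : ℝ) ^ s * (ρ⁻¹ ^ s).trace.re ^ n ∧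
      (ρ⁻¹ ^ s).trace.re ^ n ≤ (U.P n : ℝ) ^ s * (ρ ^ s).trace.re ^ n := by
    obtain ⟨R, hR, htr⟩ := CQG.UnitaryRep.exists_isModular_tpow hρ.isModular n
    have h := CQG.UnitaryRep.re_trace_pow_le_of_irrDims_le hR
      (fun d hd => U.le_P_of_mem_irrDims hd) hs
    rw [(htr s).1, (htr s).2, ← hρ.posDef.ofReal_re_trace_pow, ← hρ.posDef.inv.ofReal_re_trace_pow,
      ← Complex.ofReal_pow, ← Complex.ofReal_pow, Complex.ofReal_re, Complex.ofReal_re] at h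
    exact h
  rw [← hρ.posDef.ofReal_re_trace_pow, ← hρ.posDef.inv.ofReal_re_trace_pow, Complex.ofReal_inj]
  exact le_antisymm
    (CQG.le_of_forall_pow_le_mul hP (fun n => Nat.cast_nonneg _)
      (hρ.posDef.inv.re_trace_pow_pos s) hs fun n => (key n).1)
    (CQG.le_of_forall_pow_le_mul hP (fun n => Nat.cast_nonneg _)
      (hρ.posDef.re_trace_pow_pos s) hs fun n => (key n).2)
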